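/- **Setting.** Two elements $p/q,\,r/s$ of $\Omega=\mathbf Q\cup\{\infty\}$ (in lowest terms, $\infty=1/0$) are *Farey neighbours* if $ps-rq=\pm1$. Let $\Sigma$ be the trivalent tree dual to the Farey triangulation: its vertices are the triples of pairwise Farey neighbours, two vertices being joined by an edge when the triples share exactly two elements. The elements of $\Omega$ are called regions (they correspond to the complementary regions of $\Sigma$), and the boundary of a region $R$ runs through the vertices containing $R$. A directed edge $\vec e=(X,Y;W\to Z)$ of $\Sigma$, also written $(X,Y;\to Z)$, goes from its tail $\{X,Y,W\}$ to its head $\{X,Y,Z\}$, where $W\ne Z$; its underlying edge is $e$. Put $\Omega^0(e)=\{X,Y\}$, let $\Omega^-(\vec e)$ be the set of regions whose boundary lies in the component of $\Sigma\setminus\mathrm{int}(e)$ containing the tail of $\vec e$, and let $\Omega^{0-}(\vec e)=\Omega^0(e)\cup\Omega^-(\vec e)$. For $\mu\in\mathbf C$, a $\mu$-*Markoff map* is a function $\phi:\Omega\to\mathbf C$ such that $\phi(X)^2+\phi(Y)^2+\phi(Z)^2-\phi(X)\phi(Y)\phi(Z)=\mu$ for every vertex $\{X,Y,Z\}$ of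 $\Sigma$ and $\phi(X)\phi(Y)=\phi(Z)+\phi(W)$ for every edge $(X,Y;W\to Z)$ of $\Sigma$. Let $\log$ have imaginary part in $(-\pi,\pi]$, let $\sqrt{\ }$ be the principal square root (nonnegative real part), and let $\cosh^{-1}$ be the principal branch (real part $\ge0$, imaginary part in $(-\pi,\pi]$). Let $\mu\neq0,4$, put $\nu=\cosh^{-1}(1-\mu/2)$, and for $x\ne0$ with $x^2\neq\mu$ put $$h(x)=\tfrac12\Big(1-\sqrt{1-4/x^2}\Big),\qquad \mathfrak h(x)=\log\frac{1+(e^{\nu}-1)h(x)}{1+(e^{-\nu}-1)h(x)},\qquad \hat{\mathfrak h}(x)=\log\frac{1+(e^{\nu}-1)h(x)}{\sqrt{1-\mu/x^2}}.$$ For a $\mu$-Markoff map $\phi$ and a directed edge $\vec e=(X,Y;\to Z)$ with $x=\phi(X)$, $y=\phi(Y)$, $z=\phi(Z)$ and $x,y\neq0,\pm\sqrt\mu$, the edge weight is $$\psi(\vec e)=\log\frac{1+(e^{\nu}-1)\,z/(xy)}{\sqrt{1-\mu/x^2}\,\sqrt{1-\mu/y^2}}.$$ **Proposition.** Let $\mu\in\mathbf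 C$ with $\mu\ne0,4$, let $\phi$ be a $\mu$-Markoff map, and let $\vec e=(X,Y;\to Z)$ be a directed edge of $\Sigma$ with $\phi(X),\phi(Y)\neq\pm\sqrt\mu$. Suppose that only finitely many regions $R\in\Omega^{0-}(\vec e)$ satisfy $|\phi(R)|\le2$, and that no region $R\in\Omega^{0-}(\vec e)$ satisfies $\phi(R)\in[-2,2]$. Then the series $\sum_{R\in\Omega^-(\vec e)}\mathfrak h(\phi(R))$ converges absolutely, and $$\psi(\vec e)=\sum_{R\in\Omega^0(e)}\hat{\mathfrak h}(\phi(R))+\sum_{R\in\Omega^-(\vec e)}\mathfrak h(\phi(R))\mod 2\pi i .$$ -/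

import Mathlib

namespace GenMarkoff

/-! ### The Farey triangulation and its dual tree `Σ` -/

/-- The set `Ω` of complementary regions of `Σ`: the vertices `ℚ ∪ {∞}` of the Farey
triangulation. -/
abbrev Region : Type := OnePoint ℚ

/-- The numerator of a slope in lowest terms, with `∞ = 1/0`. -/
def Region.num (X : Region) : ℤ := OnePoint.elim X 1 fun q => q.num

/-- The denominator of a slope in lowest terms, with `∞ = 1/0`. -/
def Region.den (X : Region) : ℤ := OnePoint.elim X 0 fun q => (q.den : ℤ)

/-- `p/q` and `r/s` (in lowest terms) are Farey neighbours if `ps - rq = ±1`. -/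
def FareyNeighbor (X Y : Region) : Prop :=
  X.num * Y.den - Y.num * X.den = 1 ∨ X.num * Y.den - Y.num * X.den = -1

/-- A vertex of `Σ`: a triangle of the Farey triangulation, recorded as the set of the three
regions meeting at that vertex. -/
def Vertex : Type :=
  {s : Set Region // ∃ X Y Z : Region,
    FareyNeighbor X Y ∧ FareyNeighbor Y Z ∧ FareyNeighbor X Z ∧ s = {X, Y, Z}}

/-- The binary tree `Σ` dual to the Farey triangulation: two distinct triangles are joined by an
edge when they have a common side. -/
def dualTree : SimpleGraph Vertex where
  Adj v w := v ≠ w ∧ ∃ X Y : Region, X ≠ Y ∧ X ∈ v.1 ∧ Y ∈ v.1 ∧ X ∈ w.1 ∧ Y ∈ w.1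
  symm := ⟨fun _ _ ⟨hne, X, Y, hXY, h1, h2, h3, h4⟩ => ⟨hne.symm, X, Y, hXY, h3, h4, h1, h2⟩⟩
  loopless := ⟨fun _ h => h.1 rfl⟩

/-- A directed edge `(X, Y; W → Z)` of `Σ`: the underlying edge is `X ∩ Y`, the three regions
`X, Y, W` meet at its tail, and the three regions `X, Y, Z` meet at its head. -/
structure DirectedEdge where
  X : Region
  Y : Region
  W : Region
  Z : Region
  hXY : FareyNeighbor X Y
  hXW : FareyNeighbor X W
  hYW : FareyNeighbor Y W
  hXZ : FareyNeighbor X Z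
  hYZ : FareyNeighbor Y Z
  hWZ : W ≠ Z

namespace DirectedEdge

/-- The tail of a directed edge. -/
def tail (e : DirectedEdge) : Vertex :=
  ⟨{e.X, e.Y, e.W}, e.X, e.Y, e.W, e.hXY, e.hYW, e.hXW, rfl⟩

/-- The head of a directed edge. -/
def head (e : DirectedEdge) : Vertex :=
  ⟨{e.X, e.Y, e.Z}, e.X, e.Y, e.Z, e.hXY, e.hYZ, e.hXZ, rfl⟩

/-- The vertices of `Σ⁻(e)`, the component containing the tail of `e` of the tree `Σ` with the
(open) edge underlying `e` removed. -/
def tailComponent (e : DirectedEdge) : Set Vertex :=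
  {v | (dualTree.deleteEdges {s(e.tail, e.head)}).Reachable e.tail v}

/-- `Ω⁰(e) = {X, Y}`. -/
def Omega0 (e : DirectedEdge) : Set Region := {e.X, e.Y}

/-- `Ω⁻(e)`: the regions whose boundary lies in `Σ⁻(e)`. -/
def OmegaMinus (e : DirectedEdge) : Set Region :=
  {R | ∀ v : Vertex, R ∈ v.1 → v ∈ e.tailComponent}

/-- `Ω⁰⁻(e) = Ω⁰(e) ∪ Ω⁻(e)`. -/
def Omega0Minus (e : DirectedEdge) : Set Region := e.Omega0 ∪ e.OmegaMinus

end DirectedEdge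

/-! ### Generalized Markoff maps -/

/-- `φ : Ω → ℂ` is a `μ`-Markoff map: it satisfies the vertex relation at every vertex of `Σ`,
and the edge relation along every edge. -/
structure IsMarkoffMap (μ : ℂ) (φ : Region → ℂ) : Prop where
  vertex : ∀ X Y Z : Region, FareyNeighbor X Y → FareyNeighbor Y Z → FareyNeighbor X Z →
    φ X ^ 2 + φ Y ^ 2 + φ Z ^ 2 - φ X * φ Y * φ Z = μ
  edge : ∀ e : DirectedEdge, φ e.X * φ e.Y = φ e.Z + φ e.W

/-- `Ω_φ(k)`, the set of regions with `|φ| ≤ k`. -/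
def OmegaLE (φ : Region → ℂ) (k : ℝ) : Set Region := {X | ‖φ X‖ ≤ k}

/-- The segment `[-2, 2]` of the real line, as a subset of `ℂ`. -/
def realSegment : Set ℂ := (fun t : ℝ => (t : ℂ)) '' Set.Icc (-2) 2

/-! ### The functions `cosh⁻¹`, `h`, `𝔥`, `𝔥̂` and the edge weight

`Complex.log` has imaginary part in `(-π, π]`, and `Complex.sqrt` has nonnegative real part. -/

/-- The principal branch of `cosh⁻¹`, with real part `≥ 0` and imaginary part in `(-π, π]`. -/
noncomputable def arcosh (w : ℂ) : ℂ :=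
  Complex.log (w + Complex.sqrt (w - 1) * Complex.sqrt (w + 1))

/-- `ν = cosh⁻¹(1 - μ/2)`. -/
noncomputable def nu (μ : ℂ) : ℂ := arcosh (1 - μ / 2)

/-- `h(x) = (1 - √(1 - 4/x²)) / 2`, for `x ≠ 0`. -/
noncomputable def h (x : ℂ) : ℂ := (1 - Complex.sqrt (1 - 4 / x ^ 2)) / 2

/-- The function `𝔥 = 𝔥_τ` for `τ = μ - 2`, at `x ≠ 0` with `x² ≠ μ`. -/
noncomputable def frakH (μ x : ℂ) : ℂ :=
  Complex.log ((1 + (Complex.exp (nu μ) - 1) * h x) / (1 + (Complex.exp (-nu μ) - 1) * h x))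

/-- The specific half `𝔥̂` of `𝔥`, at `x ≠ 0` with `x² ≠ μ`. -/
noncomputable def frakHHat (μ x : ℂ) : ℂ :=
  Complex.log ((1 + (Complex.exp (nu μ) - 1) * h x) / Complex.sqrt (1 - μ / x ^ 2))

/-- The `φ`-weight `ψ(e)` of a directed edge `e = (X, Y; → Z)`, where `x, y ≠ 0` and
`x², y² ≠ μ`. -/
noncomputable def edgeWeight (μ : ℂ) (φ : Region → ℂ) (e : DirectedEdge) : ℂ :=
  Complex.log ((1 + (Complex.exp (nu μ) - 1) * (φ e.Z / (φ e.X * φ e.Y))) /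
    (Complex.sqrt (1 - μ / φ e.X ^ 2) * Complex.sqrt (1 - μ / φ e.Y ^ 2)))

end GenMarkoff

/-!
Taking exponentials turns the claim into an infinite product. Write `A t = 1 + (e^ν - 1) t` and
`B t = 1 + (e^{-ν} - 1) t`, so that `A t * B t = 1 - μ t (1 - t)` and `h (1 - h) = 1 / x²` give
`exp 𝔥(x) = A(h x) / B(h x)`. The square roots cancel and it remains to show
`A(z / (x y)) = A(h x) A(h y) ∏ exp 𝔥(φ R)`, the product being over the regions behind the edge.

*The regions behind the edge.* In integral coordinates with `X = (1, 0)`, `Y = (0, 1)`,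
`W = (1, 1)` and `Z = (1, -1)`, the component of `Σ` containing the tail consists of the triangles in
the closed positive cone (`subset_closedCone_of_mem_tailComponent`,
`mem_tailComponent_of_subset_closedCone`), so `Ω⁻` is the set of positive coprime pairs. The
Euclidean algorithm indexes it by words in two letters (`bijective_word_OmegaMinus`), that is, by the
nodes of the binary tree of edges leading away from the given one, and the edge relation computes
`φ` along the tree (`IsMarkoffMap.front_descend`).

*Growth.* If both sides of an edge exceed `2` in modulus and the modulus does not decrease from
behind to front, the same holds for all later edges, and `log (|φ| / 2)` is superadditive there; so
`∑ 1 / |φ|²` converges beyond such an edge (`IsExpanding.isTame`). If growth failed, it would fail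
along an infinite path (`exists_path_of_not_hasGrowth`). A path that turns infinitely often
eventually meets only values of modulus greater than `2`, hence has decreasing modulus at every step.
Two consecutive decreasing steps lower the modulus by an amount bounded below in terms of `|μ - 4|`
(`norm_sub_four_sq_le`), so this cannot go on forever. A path that finally follows one region `R` sees
a linear recurrence with eigenvalues `l`, `l⁻¹`, where `φ R = l + l⁻¹`; since `φ R` is not in
`[-2, 2]` and `φ R ^ 2 ≠ μ`, it grows geometrically (`exists_isTame_replicate`). The condition
`φ R ^ 2 ≠ μ` holds for every `R` in `Ω⁻`, since otherwise the values around `R` would form a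
geometric progression and infinitely many would be small (`IsAdmissible.front_sq_ne`).

*The product.* The ratio of `A(z / (x y))` and `A(h x) A(h y)` satisfies a recursion along the tree
(`IsAdmissible.ratio_eq`), hence equals its product over the edges at depth `n` times the product of
`exp 𝔥` over the regions met before. For all but finitely many edges the modulus grows
from behind to front, which puts `z / (x y)` close to `h x` instead of `1 - h x`; the ratio then
differs from `1` by `O(1 / |y|²)` with `y` the region just met
(`IsAdmissible.exists_norm_ratio_child_le`). By summability the product at depth `n` tends to `1`.
-/

open Filter Topology

namespace GenMarkoff

/-! ### Coordinates on the Farey triangulation -/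

/-- The region of slope `a / b`, with `b = 0` giving `∞`. -/
def Region.ofInts (a b : ℤ) : Region :=
  if b = 0 then OnePoint.infty else (((a : ℚ) / (b : ℚ) : ℚ) : OnePoint ℚ)

theorem Region.num_infty : Region.num OnePoint.infty = 1 := rfl
theorem Region.den_infty : Region.den OnePoint.infty = 0 := rfl
theorem Region.num_coe (q : ℚ) : Region.num (q : OnePoint ℚ) = q.num := rfl
theorem Region.den_coe (q : ℚ) : Region.den (q : OnePoint ℚ) = (q.den : ℤ) := rfl

theorem Region.isCoprime_num_den (R : Region) : IsCoprime R.num R.den := by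
  induction R using OnePoint.rec with
  | infty => exact isCoprime_one_left
  | coe q =>
    rw [Region.num_coe, Region.den_coe, Int.isCoprime_iff_nat_coprime]
    simpa using q.reduced

/-- A region is determined by its slope. -/
theorem Region.ext_of_det {R S : Region} (h : R.num * S.den - S.num * R.den = 0) : R = S := by
  induction R using OnePoint.rec with
  | infty =>
    induction S using OnePoint.rec with
    | infty => rfl
    | coe q => simp [Region.num_infty, Region.den_infty, Region.num_coe, Region.den_coe] at h
  | coe p =>
    induction S using OnePoint.rec with
    | infty => simp [Region.num_infty, Region.den_infty, Region.num_coe, Region.den_coe] at h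
    | coe q =>
      simp only [Region.num_coe, Region.den_coe] at h
      rw [Rat.eq_iff_mul_eq_mul.2 (sub_eq_zero.1 h)]

theorem Region.num_den_ofInts {a b : ℤ} (h : IsCoprime a b) :
    ((Region.ofInts a b).num = a ∧ (Region.ofInts a b).den = b) ∨
      ((Region.ofInts a b).num = -a ∧ (Region.ofInts a b).den = -b) := by
  unfold Region.ofInts
  rcases lt_trichotomy b 0 with hb | rfl | hb
  · right
    rw [if_neg hb.ne, Region.num_coe, Region.den_coe]
    have h' : Nat.Coprime (-a).natAbs (-b).natAbs := by
      simpa using Int.isCoprime_iff_nat_coprime.1 h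
    have e : (a : ℚ) / b = ((-a : ℤ) : ℚ) / ((-b : ℤ) : ℚ) := by push_cast; rw [neg_div_neg_eq]
    rw [e]
    exact ⟨Rat.num_div_eq_of_coprime (by omega) h', Rat.den_div_eq_of_coprime (by omega) h'⟩
  · rw [if_pos rfl, Region.num_infty, Region.den_infty]
    rw [isCoprime_zero_right, Int.isUnit_iff] at h
    omega
  · left
    rw [if_neg hb.ne', Region.num_coe, Region.den_coe]
    have h' := Int.isCoprime_iff_nat_coprime.1 h
    exact ⟨Rat.num_div_eq_of_coprime hb h', Rat.den_div_eq_of_coprime hb h'⟩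

/-- Homogeneous integral coordinates on the set of regions: every region is `G a b` for coprime
`a, b`, and both equality and Farey neighbourhood are read off from the determinant. -/
structure IsChart (G : ℤ → ℤ → Region) : Prop where
  surj : ∀ R, ∃ a b, IsCoprime a b ∧ G a b = R
  neighbor : ∀ {a b c d}, IsCoprime a b → IsCoprime c d →
    (FareyNeighbor (G a b) (G c d) ↔ a * d - c * b = 1 ∨ a * d - c * b = -1)
  eq_iff : ∀ {a b c d}, IsCoprime a b → IsCoprime c d → (G a b = G c d ↔ a * d - c * b = 0)

theorem isChart_ofInts : IsChart Region.ofInts where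
  surj R := by
    refine ⟨R.num, R.den, R.isCoprime_num_den, Region.ext_of_det ?_⟩
    rcases Region.num_den_ofInts R.isCoprime_num_den with ⟨h1, h2⟩ | ⟨h1, h2⟩ <;>
      rw [h1, h2] <;> ring
  neighbor {a b c d} hab hcd := by
    unfold FareyNeighbor
    rcases Region.num_den_ofInts hab with ⟨h1, h2⟩ | ⟨h1, h2⟩ <;>
      rcases Region.num_den_ofInts hcd with ⟨h3, h4⟩ | ⟨h3, h4⟩ <;>
      rw [h1, h2, h3, h4] <;> ring_nf <;> omega
  eq_iff {a b c d} hab hcd := by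
    have key : Region.ofInts a b = Region.ofInts c d ↔
        (Region.ofInts a b).num * (Region.ofInts c d).den
          - (Region.ofInts c d).num * (Region.ofInts a b).den = 0 :=
      ⟨fun h => by rw [h]; ring, Region.ext_of_det⟩
    rw [key]
    rcases Region.num_den_ofInts hab with ⟨h1, h2⟩ | ⟨h1, h2⟩ <;>
      rcases Region.num_den_ofInts hcd with ⟨h3, h4⟩ | ⟨h3, h4⟩ <;>
      rw [h1, h2, h3, h4] <;> ring_nf <;> omega

theorem isCoprime_of_det {a b c d : ℤ} (h : a * d - c * b = 1 ∨ a * d - c * b = -1) :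
    IsCoprime a b := by
  rcases h with h | h
  · exact ⟨d, -c, by linear_combination h⟩
  · exact ⟨-d, c, by linear_combination -h⟩

/-- An integral change of basis carries coordinates to coordinates. -/
theorem IsChart.comp {G : ℤ → ℤ → Region} (hG : IsChart G) {p q r s : ℤ}
    (hdet : p * s - r * q = 1 ∨ p * s - r * q = -1) :
    IsChart fun a b => G (a * p + b * r) (a * q + b * s) := by
  have cop : ∀ {a b : ℤ}, IsCoprime a b → IsCoprime (a * p + b * r) (a * q + b * s) := by
    rintro a b ⟨u, v, h⟩
    rcases hdet with hd | hd
    · exact ⟨u * s - v * q, v * p - u * r, by linear_combination hd + (p * s - r * q) * h⟩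
    · exact ⟨-(u * s - v * q), -(v * p - u * r), by linear_combination -hd - (p * s - r * q) * h⟩
  have det : ∀ a b c d : ℤ, (a * p + b * r) * (c * q + d * s) - (c * p + d * r) * (a * q + b * s)
      = (a * d - c * b) * (p * s - r * q) := fun a b c d => by ring
  refine ⟨fun R => ?_, fun {a b c d} h1 h2 => ?_, fun {a b c d} h1 h2 => ?_⟩
  · obtain ⟨m, n, ⟨u, v, h⟩, rfl⟩ := hG.surj R
    rcases hdet with hd | hd
    · refine ⟨m * s - n * r, n * p - m * q, ⟨u * p + v * q, u * r + v * s, ?_⟩, ?_⟩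
      · linear_combination hd + (p * s - r * q) * h
      · congr 1
        · linear_combination m * hd
        · linear_combination n * hd
    · refine ⟨-(m * s - n * r), -(n * p - m * q), ⟨u * p + v * q, u * r + v * s, ?_⟩, ?_⟩
      · linear_combination -hd - (p * s - r * q) * h
      · congr 1
        · linear_combination -m * hd
        · linear_combination -n * hd
  · rw [hG.neighbor (cop h1) (cop h2), det]
    rcases hdet with hd | hd <;> rw [hd] <;> omega
  · rw [hG.eq_iff (cop h1) (cop h2), det]
    rcases hdet with hd | hd <;> rw [hd] <;> omega

/-- The two common neighbours of `(1, 0)` and `(0, 1)`. -/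
theorem IsChart.eq_or_eq_of_common_neighbor {G : ℤ → ℤ → Region} (hG : IsChart G) {R : Region}
    (h1 : FareyNeighbor (G 1 0) R) (h2 : FareyNeighbor (G 0 1) R) : R = G 1 1 ∨ R = G 1 (-1) := by
  obtain ⟨a, b, hab, rfl⟩ := hG.surj R
  rw [hG.neighbor isCoprime_one_left hab] at h1
  rw [hG.neighbor isCoprime_one_right hab] at h2
  rw [hG.eq_iff hab isCoprime_one_left, hG.eq_iff hab isCoprime_one_left]
  omega

/-- Coordinates adapted to a directed edge: `X = (1, 0)`, `Y = (0, 1)`, the region at the tail is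
`(1, 1)` and the region at the head is `(1, -1)`. -/
theorem DirectedEdge.exists_chart (e : DirectedEdge) : ∃ G : ℤ → ℤ → Region, IsChart G ∧
    G 1 0 = e.X ∧ G 0 1 = e.Y ∧ G 1 1 = e.W ∧ G 1 (-1) = e.Z := by
  obtain ⟨p, q, hX, eX⟩ := isChart_ofInts.surj e.X
  obtain ⟨r, s, hY, eY⟩ := isChart_ofInts.surj e.Y
  have hdet := e.hXY
  rw [← eX, ← eY, isChart_ofInts.neighbor hX hY] at hdet
  have c01 : IsCoprime (0 : ℤ) 1 := isCoprime_one_right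
  have hG := isChart_ofInts.comp hdet
  set G := fun a b => Region.ofInts (a * p + b * r) (a * q + b * s) with hGdef
  have h1 : G 1 0 = e.X := by simp [hGdef, eX]
  have h2 : G 0 1 = e.Y := by simp [hGdef, eY]
  rcases hG.eq_or_eq_of_common_neighbor (h1 ▸ e.hXW) (h2 ▸ e.hYW) with hW | hW <;>
    rcases hG.eq_or_eq_of_common_neighbor (h1 ▸ e.hXZ) (h2 ▸ e.hYZ) with hZ | hZ
  · exact absurd (hW.trans hZ.symm) e.hWZ
  · exact ⟨G, hG, h1, h2, hW.symm, hZ.symm⟩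
  -- The other orientation is corrected by changing the sign of the second coordinate.
  · refine ⟨_, hG.comp (p := 1) (q := 0) (r := 0) (s := -1) (by norm_num), ?_, ?_, ?_, ?_⟩
    · simpa using h1
    · rw [← h2]
      have := (hG.eq_iff (a := 0) (b := -1) (c := 0) (d := 1) c01.neg_right c01).2 (by norm_num)
      simpa using this
    · simpa using hW.symm
    · simpa using hZ.symm
  · exact absurd (hW.trans hZ.symm) e.hWZ

/-! ### The regions behind a directed edge -/

/-- The closed cone of regions with nonnegative coordinates. -/
def closedCone (G : ℤ → ℤ → Region) : Set Region :=
  {R | ∃ a b, 0 ≤ a ∧ 0 ≤ b ∧ IsCoprime a b ∧ G a b = R}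

theorem FareyNeighbor.symm {X Y : Region} (h : FareyNeighbor X Y) : FareyNeighbor Y X := by
  unfold FareyNeighbor at *
  omega

theorem IsChart.neg {G : ℤ → ℤ → Region} (hG : IsChart G) {a b : ℤ} (h : IsCoprime a b) :
    G (-a) (-b) = G a b :=
  (hG.eq_iff h.neg_neg h).2 (by ring)

/-- All neighbours of a region with positive coordinates have nonnegative coordinates. -/
theorem IsChart.mem_closedCone_of_neighbor {G : ℤ → ℤ → Region} (hG : IsChart G) {a b : ℤ}
    (ha : 0 < a) (hb : 0 < b) (hab : IsCoprime a b) {S : Region} (hS : FareyNeighbor (G a b) S) :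
    S ∈ closedCone G := by
  obtain ⟨c, d, hcd, rfl⟩ := hG.surj S
  rw [hG.neighbor hab hcd] at hS
  rcases le_or_gt 0 c with hc | hc <;> rcases le_or_gt 0 d with hd | hd
  · exact ⟨c, d, hc, hd, hcd, rfl⟩
  · rcases hc.eq_or_lt with rfl | hc
    · exact ⟨-0, -d, by simp, by omega, hcd.neg_neg, hG.neg hcd⟩
    · have : 0 < c * b := mul_pos hc hb
      have : 0 < a * -d := mul_pos ha (by omega)
      rw [mul_neg] at this
      omega
  · rcases hd.eq_or_lt with rfl | hd
    · exact ⟨-c, -0, by omega, by simp, hcd.neg_neg, hG.neg hcd⟩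
    · have : 0 < -c * b := mul_pos (by omega) hb
      rw [neg_mul] at this
      have : 0 < a * d := mul_pos ha hd
      omega
  · exact ⟨-c, -d, by omega, by omega, hcd.neg_neg, hG.neg hcd⟩

/-- Regions with coordinates of strictly opposite signs do not lie in the closed cone. -/
theorem IsChart.notMem_closedCone {G : ℤ → ℤ → Region} (hG : IsChart G) {a b : ℤ}
    (ha : 0 < a) (hb : b < 0) (hab : IsCoprime a b) : G a b ∉ closedCone G := by
  rintro ⟨c, d, hc, hd, hcd, h⟩
  rw [hG.eq_iff hcd hab] at h
  have h1 : 0 ≤ c * -b := mul_nonneg hc (by omega)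
  have h2 : 0 ≤ a * d := mul_nonneg ha.le hd
  rw [mul_neg] at h1
  have h3 : c * b = 0 := by omega
  have h4 : a * d = 0 := by omega
  have h5 : c = 0 := by simpa [hb.ne] using h3
  have h6 : d = 0 := by simpa [ha.ne'] using h4
  subst h5 h6
  exact not_isCoprime_zero_zero hcd

theorem Vertex.exists_third (v : Vertex) {P Q : Region} (hPQ : P ≠ Q) (hP : P ∈ v.1)
    (hQ : Q ∈ v.1) : ∃ T, FareyNeighbor P Q ∧ FareyNeighbor P T ∧ FareyNeighbor Q T ∧
      v.1 = {P, Q, T} := by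
  obtain ⟨A, B, C, hAB, hBC, hAC, hv⟩ := v.2
  rw [hv] at hP hQ ⊢
  simp only [Set.mem_insert_iff, Set.mem_singleton_iff] at hP hQ
  rcases hP with rfl | rfl | rfl <;> rcases hQ with rfl | rfl | rfl
  · exact absurd rfl hPQ
  · exact ⟨C, hAB, hAC, hBC, rfl⟩
  · exact ⟨B, hAC, hAB, hBC.symm, by ext; simp; tauto⟩
  · exact ⟨C, hAB.symm, hBC, hAC, by ext; simp; tauto⟩
  · exact absurd rfl hPQ
  · exact ⟨A, hBC, hAB.symm, hAC.symm, by ext; simp; tauto⟩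
  · exact ⟨B, hAC.symm, hBC.symm, hAB, by ext; simp; tauto⟩
  · exact ⟨A, hBC.symm, hAC.symm, hAB.symm, by ext; simp; tauto⟩
  · exact absurd rfl hPQ

/-- A region of the closed cone is one of the two sides `(1, 0)`, `(0, 1)`, or has positive
coordinates. -/
theorem mem_closedCone_cases {G : ℤ → ℤ → Region} {R : Region} (hR : R ∈ closedCone G) :
    R = G 1 0 ∨ R = G 0 1 ∨ ∃ a b, 0 < a ∧ 0 < b ∧ IsCoprime a b ∧ G a b = R := by
  obtain ⟨a, b, ha, hb, hab, rfl⟩ := hR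
  rcases ha.eq_or_lt with rfl | ha
  · rw [isCoprime_zero_left, Int.isUnit_iff] at hab
    obtain rfl : b = 1 := by omega
    simp
  · rcases hb.eq_or_lt with rfl | hb
    · rw [isCoprime_zero_right, Int.isUnit_iff] at hab
      obtain rfl : a = 1 := by omega
      simp
    · exact .inr (.inr ⟨a, b, ha, hb, hab, rfl⟩)

section AdaptedChart

variable {e : DirectedEdge} {G : ℤ → ℤ → Region}

/-- The set of vertices contained in the closed cone cannot be left without crossing the edge
underlying `e`. -/
theorem subset_closedCone_of_adj (hG : IsChart G) (hX : G 1 0 = e.X) (hY : G 0 1 = e.Y)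
    (hW : G 1 1 = e.W) (hZ : G 1 (-1) = e.Z) {v w : Vertex} (hv : v.1 ⊆ closedCone G)
    (hvw : (dualTree.deleteEdges {s(e.tail, e.head)}).Adj v w) : w.1 ⊆ closedCone G := by
  rw [SimpleGraph.deleteEdges_adj] at hvw
  obtain ⟨⟨hne, P, Q, hPQ, hPv, hQv, hPw, hQw⟩, hdel⟩ := hvw
  obtain ⟨T, -, hPT, hQT, hvT⟩ := v.exists_third hPQ hPv hQv
  obtain ⟨T', -, hPT', hQT', hwT⟩ := w.exists_third hPQ hPw hQw
  have hTT : T ≠ T' := by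
    rintro rfl
    exact hne (Subtype.ext (hvT.trans hwT.symm))
  have hZc : e.Z ∉ closedCone G := hZ ▸ hG.notMem_closedCone one_pos (by norm_num) isCoprime_one_left
  have hTc : T ∈ closedCone G := hv (by rw [hvT]; simp)
  suffices hT' : T' ∈ closedCone G by
    rw [hwT]
    rintro R (rfl | rfl | rfl)
    exacts [hv hPv, hv hQv, hT']
  -- If both common sides are `X` and `Y`, the edge from `v` to `w` is the deleted one.
  have crossing : ({P, Q} : Set Region) = {e.X, e.Y} → (FareyNeighbor (G 1 0) T) →
      FareyNeighbor (G 0 1) T → FareyNeighbor (G 1 0) T' → FareyNeighbor (G 0 1) T' → False := by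
    intro hs a1 a2 a3 a4
    have hT : T = e.W := by
      rcases hG.eq_or_eq_of_common_neighbor a1 a2 with h | h
      · exact h.trans hW
      · exact absurd (h.trans hZ ▸ hTc) hZc
    have hT2 : T' = e.Z := by
      rcases hG.eq_or_eq_of_common_neighbor a3 a4 with h | h
      · exact absurd (hT.trans (h.trans hW).symm) hTT
      · exact h.trans hZ
    apply hdel
    have e1 : v = e.tail := Subtype.ext (by
      rw [hvT, hT, Set.insert_eq, Set.insert_eq, ← Set.union_assoc, ← Set.insert_eq, hs]
      simp only [DirectedEdge.tail]
      ext; simp; tauto)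
    have e2 : w = e.head := Subtype.ext (by
      rw [hwT, hT2, Set.insert_eq, Set.insert_eq, ← Set.union_assoc, ← Set.insert_eq, hs]
      simp only [DirectedEdge.head]
      ext; simp; tauto)
    rw [e1, e2]
    rfl
  rcases mem_closedCone_cases (hv hPv) with hP | hP | ⟨a, b, ha, hb, hab, rfl⟩
  · rcases mem_closedCone_cases (hv hQv) with hQ | hQ | ⟨a, b, ha, hb, hab, rfl⟩
    · exact absurd (hP.trans hQ.symm) hPQ
    · rw [hP] at hPT hPT'
      rw [hQ] at hQT hQT'
      exact (crossing (by rw [hP, hQ, hX, hY]) hPT hQT hPT' hQT').elim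
    · exact hG.mem_closedCone_of_neighbor ha hb hab hQT'
  · rcases mem_closedCone_cases (hv hQv) with hQ | hQ | ⟨a, b, ha, hb, hab, rfl⟩
    · rw [hP] at hPT hPT'
      rw [hQ] at hQT hQT'
      exact (crossing (by rw [hP, hQ, hX, hY, Set.pair_comm]) hQT hPT hQT' hPT').elim
    · exact absurd (hP.trans hQ.symm) hPQ
    · exact hG.mem_closedCone_of_neighbor ha hb hab hQT'
  · exact hG.mem_closedCone_of_neighbor ha hb hab hPT'

theorem subset_closedCone_of_mem_tailComponent (hG : IsChart G) (hX : G 1 0 = e.X)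
    (hY : G 0 1 = e.Y) (hW : G 1 1 = e.W) (hZ : G 1 (-1) = e.Z) {v : Vertex}
    (hv : v ∈ e.tailComponent) : v.1 ⊆ closedCone G := by
  have h := (SimpleGraph.reachable_iff_reflTransGen _ _).1 hv
  induction h with
  | refl =>
    rintro R (rfl | rfl | rfl)
    · exact ⟨1, 0, by simp, by simp, isCoprime_one_left, hX⟩
    · exact ⟨0, 1, by simp, by simp, isCoprime_one_right, hY⟩
    · exact ⟨1, 1, by simp, by simp, isCoprime_one_left, hW⟩
  | tail h1 h2 ih =>
    exact subset_closedCone_of_adj hG hX hY hW hZ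
      (ih ((SimpleGraph.reachable_iff_reflTransGen _ _).2 h1)) h2

/-- Descent by subtraction from a triangle of the closed cone to the tail of `e`. -/
theorem mem_tailComponent_of_det (hG : IsChart G) (hX : G 1 0 = e.X)
    (hY : G 0 1 = e.Y) (hW : G 1 1 = e.W) (hZ : G 1 (-1) = e.Z) {a b c d : ℤ}
    (ha : 0 ≤ a) (hb : 0 ≤ b) (hc : 0 ≤ c) (hd : 0 ≤ d)
    (hdet : a * d - c * b = 1 ∨ a * d - c * b = -1) {v : Vertex}
    (hv : v.1 = {G a b, G c d, G (a + c) (b + d)}) : v ∈ e.tailComponent := by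
  obtain ⟨n, hn⟩ : ∃ n : ℕ, (a + b + c + d).toNat = n := ⟨_, rfl⟩
  induction n using Nat.strong_induction_on generalizing a b c d v with
  | _ n ih =>
    have hZc : e.Z ∉ closedCone G :=
      hZ ▸ hG.notMem_closedCone one_pos (by norm_num) isCoprime_one_left
    have cab : IsCoprime a b := isCoprime_of_det hdet
    have ccd : IsCoprime c d := isCoprime_of_det (c := a) (d := b) (by omega)
    have csum : IsCoprime (a + c) (b + d) := isCoprime_of_det (c := c) (d := d)
      (hdet.imp (fun h => by linarith) fun h => by linarith)
    -- The step from `{p, q, p + q}` to `{p, q - p, q}` when `q - p` has nonnegative coordinates.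
    have step : ∀ {a b c d : ℤ}, 0 ≤ a → 0 ≤ b → 0 ≤ c → 0 ≤ d →
        (a * d - c * b = 1 ∨ a * d - c * b = -1) →
        v.1 = {G a b, G c d, G (a + c) (b + d)} → (a + b + c + d).toNat = n →
        a ≤ c → b ≤ d → v ∈ e.tailComponent := by
      intro a b c d ha hb hc hd hdet hv hn hac hbd
      have cab : IsCoprime a b := isCoprime_of_det hdet
      have ccd : IsCoprime c d := isCoprime_of_det (c := a) (d := b) (by omega)
      have csum : IsCoprime (a + c) (b + d) := isCoprime_of_det (c := c) (d := d)
        (hdet.imp (fun h => by linarith) fun h => by linarith)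
      have hdet' : a * (d - b) - (c - a) * b = 1 ∨ a * (d - b) - (c - a) * b = -1 :=
        hdet.imp (fun h => by linarith) fun h => by linarith
      have hdet'' : (c - a) * d - c * (d - b) = 1 ∨ (c - a) * d - c * (d - b) = -1 :=
        hdet.symm.imp (fun h => by linarith) fun h => by linarith
      have cdiff : IsCoprime (c - a) (d - b) := isCoprime_of_det (c := c) (d := d) hdet''
      let w : Vertex := ⟨{G a b, G (c - a) (d - b), G c d}, G a b, G (c - a) (d - b), G c d,
        (hG.neighbor cab cdiff).2 hdet', (hG.neighbor cdiff ccd).2 hdet'',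
        (hG.neighbor cab ccd).2 hdet, rfl⟩
      have hpos : 0 < a + b := by
        by_contra hcon
        obtain rfl : a = 0 := by omega
        obtain rfl : b = 0 := by omega
        simp at hdet
      have hw : w ∈ e.tailComponent := by
        refine ih (a + b + (c - a) + (d - b)).toNat (by omega) ha hb (sub_nonneg.2 hac)
          (sub_nonneg.2 hbd) hdet' ?_ rfl
        simp only [w, add_sub_cancel]
      have hne : w ≠ v := by
        intro hwv
        have hmem : G (c - a) (d - b) ∈ v.1 := by rw [← hwv]; simp [w]
        rw [hv] at hmem
        simp only [Set.mem_insert_iff, Set.mem_singleton_iff, hG.eq_iff cdiff cab,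
          hG.eq_iff cdiff ccd, hG.eq_iff cdiff csum] at hmem
        ring_nf at hmem hdet
        omega
      refine SimpleGraph.Reachable.trans hw (SimpleGraph.Adj.reachable ?_)
      rw [SimpleGraph.deleteEdges_adj]
      refine ⟨⟨hne, G a b, G c d, ?_, by simp [w], by simp [w], by simp [hv], by simp [hv]⟩, ?_⟩
      · rw [Ne, hG.eq_iff cab ccd]
        omega
      · intro hs
        have hhead : e.Z ∈ e.head.1 := by simp [DirectedEdge.head]
        rcases Sym2.eq_iff.1 (Set.mem_singleton_iff.1 hs) with ⟨-, h⟩ | ⟨h, -⟩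
        · rw [← h, hv] at hhead
          apply hZc
          rcases hhead with h | h | h <;> rw [h]
          · exact ⟨a, b, ha, hb, cab, rfl⟩
          · exact ⟨c, d, hc, hd, ccd, rfl⟩
          · exact ⟨_, _, add_nonneg ha hc, add_nonneg hb hd, csum, rfl⟩
        · rw [← h] at hhead
          apply hZc
          rcases hhead with h | h | h <;> rw [h]
          · exact ⟨a, b, ha, hb, cab, rfl⟩
          · exact ⟨_, _, sub_nonneg.2 hac, sub_nonneg.2 hbd, cdiff, rfl⟩
          · exact ⟨c, d, hc, hd, ccd, rfl⟩
    have hv' : v.1 = {G c d, G a b, G (c + a) (d + b)} := by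
      rw [hv, add_comm c, add_comm d]; ext; simp; tauto
    -- Incomparable `(a, b)`, `(c, d)` with determinant `±1` form the standard basis.
    have base : ∀ {a b c d : ℤ}, 0 ≤ b → 0 ≤ c →
        (a * d - c * b = 1 ∨ a * d - c * b = -1) → c < a → b < d →
        a = 1 ∧ b = 0 ∧ c = 0 ∧ d = 1 := by
      intro a b c d hb hc hdet h1 h2
      have h3 : (c + 1) * (b + 1) ≤ a * d := mul_le_mul h1 h2 (by omega) (by omega)
      ring_nf at h3 hdet
      have h4 : b = 0 := by omega
      have h5 : c = 0 := by omega
      subst h4 h5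
      simp only [mul_zero] at hdet
      have h6 : a * d = 1 := by
        have : 0 < a * d := mul_pos h1 h2
        omega
      have := Int.eq_one_or_neg_one_of_mul_eq_one' h6
      omega
    rcases le_or_gt a c with hac | hac <;> rcases le_or_gt b d with hbd | hbd
    · exact step ha hb hc hd hdet hv hn hac hbd
    · rcases hac.eq_or_lt with rfl | hac
      · exact step hc hd ha hb (by omega) hv' (by omega) le_rfl hbd.le
      · obtain ⟨rfl, rfl, rfl, rfl⟩ := base hd ha (by omega) hac hbd
        have : v = e.tail := Subtype.ext (by
          rw [hv']; simp [DirectedEdge.tail, hX, hY, hW])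
        rw [this]
        exact SimpleGraph.Reachable.refl _
    · rcases hbd.eq_or_lt with rfl | hbd
      · exact step hc hd ha hb (by omega) hv' (by omega) hac.le le_rfl
      · obtain ⟨rfl, rfl, rfl, rfl⟩ := base hb hc hdet hac hbd
        have : v = e.tail := Subtype.ext (by
          rw [hv]; simp [DirectedEdge.tail, hX, hY, hW])
        rw [this]
        exact SimpleGraph.Reachable.refl _
    · exact step hc hd ha hb (by omega) hv' (by omega) hac.le hbd.le

theorem mem_tailComponent_of_subset_closedCone (hG : IsChart G) (hX : G 1 0 = e.X)
    (hY : G 0 1 = e.Y) (hW : G 1 1 = e.W) (hZ : G 1 (-1) = e.Z) {v : Vertex}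
    (hv : v.1 ⊆ closedCone G) : v ∈ e.tailComponent := by
  obtain ⟨P, Q, T, hPQ, hQT, hPT, hvs⟩ := v.2
  obtain ⟨a, b, ha, hb, hab, rfl⟩ := hv (show P ∈ v.1 by rw [hvs]; simp)
  obtain ⟨c, d, hc, hd, hcd, rfl⟩ := hv (show Q ∈ v.1 by rw [hvs]; simp)
  obtain ⟨m, n, hm, hn, hmn, rfl⟩ := hv (show T ∈ v.1 by rw [hvs]; simp)
  rw [hG.neighbor hab hcd] at hPQ
  rw [hG.neighbor hcd hmn] at hQT
  rw [hG.neighbor hab hmn] at hPT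
  -- Cramer's rule expresses `(m, n)` in the basis `(a, b)`, `(c, d)`.
  have e1 : m * (a * d - c * b) = a * (m * d - c * n) + c * (a * n - m * b) := by ring
  have e2 : n * (a * d - c * b) = b * (m * d - c * n) + d * (a * n - m * b) := by ring
  have hQT' : m * d - c * n = 1 ∨ m * d - c * n = -1 := by omega
  have key : (m = a + c ∧ n = b + d) ∨ (a = c + m ∧ b = d + n) ∨ (c = a + m ∧ d = b + n) := by
    rcases hPQ with h1 | h1 <;> rcases hQT' with h2 | h2 <;> rcases hPT with h3 | h3 <;>
      rw [h1, h2, h3] at e1 e2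
    all_goals omega
  rcases key with ⟨rfl, rfl⟩ | ⟨rfl, rfl⟩ | ⟨rfl, rfl⟩
  · exact mem_tailComponent_of_det hG hX hY hW hZ ha hb hc hd hPQ hvs
  · exact mem_tailComponent_of_det hG hX hY hW hZ hc hd hm hn hQT (hvs.trans (by ext; simp; tauto))
  · exact mem_tailComponent_of_det hG hX hY hW hZ ha hb hm hn hPT (hvs.trans (by ext; simp; tauto))

theorem IsChart.exists_vertex {G : ℤ → ℤ → Region} (hG : IsChart G) (R : Region) :
    ∃ v : Vertex, R ∈ v.1 := by
  obtain ⟨a, b, ⟨u, v, h⟩, rfl⟩ := hG.surj R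
  have d1 : a * u - -v * b = 1 := by linear_combination h
  have d2 : a * (b + u) - (a - v) * b = 1 := by linear_combination h
  have d3 : -v * (b + u) - (a - v) * u = -1 := by linear_combination -h
  have c1 : IsCoprime a b := ⟨u, v, h⟩
  have c2 : IsCoprime (-v) u := isCoprime_of_det (.inr d3)
  have c3 : IsCoprime (a - v) (b + u) := ⟨u, v, by linear_combination h⟩
  exact ⟨⟨{G a b, G (-v) u, G (a - v) (b + u)}, G a b, G (-v) u, G (a - v) (b + u),
    (hG.neighbor c1 c2).2 (.inl d1), (hG.neighbor c2 c3).2 (.inr d3),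
    (hG.neighbor c1 c3).2 (.inl d2), rfl⟩, by simp⟩

/-- In adapted coordinates, `Ω⁻(e)` is the open positive cone. -/
theorem mem_OmegaMinus_iff (hG : IsChart G) (hX : G 1 0 = e.X)
    (hY : G 0 1 = e.Y) (hW : G 1 1 = e.W) (hZ : G 1 (-1) = e.Z) {R : Region} :
    R ∈ e.OmegaMinus ↔ ∃ a b, 0 < a ∧ 0 < b ∧ IsCoprime a b ∧ G a b = R := by
  constructor
  · intro hR
    obtain ⟨v, hv⟩ := hG.exists_vertex R
    have hhead : e.head ∉ e.tailComponent := fun h =>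
      (hZ ▸ hG.notMem_closedCone one_pos (by norm_num) isCoprime_one_left : e.Z ∉ closedCone G)
        (subset_closedCone_of_mem_tailComponent hG hX hY hW hZ h (by simp [DirectedEdge.head]))
    rcases mem_closedCone_cases
      (subset_closedCone_of_mem_tailComponent hG hX hY hW hZ (hR v hv) hv) with h | h | h
    · exact absurd (hR e.head (by simp [DirectedEdge.head, h, hX])) hhead
    · exact absurd (hR e.head (by simp [DirectedEdge.head, h, hY])) hhead
    · exact h
  · rintro ⟨a, b, ha, hb, hab, rfl⟩ v hv
    refine mem_tailComponent_of_subset_closedCone hG hX hY hW hZ fun S hS => ?_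
    by_cases h : G a b = S
    · exact ⟨a, b, ha.le, hb.le, hab, h⟩
    · obtain ⟨T, hn, -, -, -⟩ := v.exists_third h hv hS
      exact hG.mem_closedCone_of_neighbor ha hb hab hn

end AdaptedChart

/-! ### The binary tree of coprime pairs -/

/-- The coordinates of the region reached by a word in the binary tree behind an edge: each letter
tells which of the two outgoing edges is taken. The state `(p, q)` of two adjacent coordinate
vectors, with new region `p + q`, moves to `(p, p + q)` for `false` and to `(q, p + q)` for
`true`. -/
def wordCoord : List Bool → ℤ × ℤ
  | [] => (1, 1)
  | false :: u => ((wordCoord u).1 + (wordCoord u).2, (wordCoord u).2)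
  | true :: u => ((wordCoord u).2, (wordCoord u).1 + (wordCoord u).2)

theorem wordCoord_pos (u : List Bool) : 0 < (wordCoord u).1 ∧ 0 < (wordCoord u).2 := by
  induction u with
  | nil => simp [wordCoord]
  | cons b u ih => cases b <;> simp only [wordCoord] <;> omega

theorem isCoprime_wordCoord (u : List Bool) : IsCoprime (wordCoord u).1 (wordCoord u).2 := by
  induction u with
  | nil => simp [wordCoord, isCoprime_one_left]
  | cons b u ih =>
    obtain ⟨m, n, h⟩ := ih
    cases b
    · exact ⟨m, n - m, by simp only [wordCoord]; linear_combination h⟩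
    · exact ⟨n - m, m, by simp only [wordCoord]; linear_combination h⟩

theorem wordCoord_injective : Function.Injective wordCoord := by
  intro u
  induction u with
  | nil =>
    intro v h
    match v with
    | [] => rfl
    | b :: v =>
      have hv := wordCoord_pos v
      have h1 := congrArg Prod.fst h
      have h2 := congrArg Prod.snd h
      cases b <;> simp only [wordCoord] at h1 h2 <;> omega
  | cons a u ih =>
    intro v h
    have hu := wordCoord_pos u
    have h1 := congrArg Prod.fst h
    have h2 := congrArg Prod.snd h
    match v with
    | [] => cases a <;> simp only [wordCoord] at h1 h2 <;> omega
    | b :: v =>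
      have hv := wordCoord_pos v
      cases a <;> cases b <;> simp only [wordCoord] at h1 h2
      · rw [@ih v (Prod.ext (by omega) (by omega))]
      · omega
      · omega
      · rw [@ih v (Prod.ext (by omega) (by omega))]

theorem exists_wordCoord_eq {a b : ℤ} (ha : 0 < a) (hb : 0 < b) (hab : IsCoprime a b) :
    ∃ u, wordCoord u = (a, b) := by
  obtain ⟨n, hn⟩ : ∃ n : ℕ, (a + b).toNat = n := ⟨_, rfl⟩
  induction n using Nat.strong_induction_on generalizing a b with
  | _ n ih =>
    rcases lt_trichotomy a b with h | rfl | h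
    · obtain ⟨m, k, hmk⟩ := hab
      obtain ⟨u, hu⟩ := ih (b - a + a).toNat (by omega) (a := b - a) (b := a) (by omega) ha
        ⟨k, m + k, by linear_combination hmk⟩ rfl
      exact ⟨true :: u, by simp [wordCoord, hu]⟩
    · rw [isCoprime_self, Int.isUnit_iff] at hab
      obtain rfl : a = 1 := by omega
      exact ⟨[], rfl⟩
    · obtain ⟨m, k, hmk⟩ := hab
      obtain ⟨u, hu⟩ := ih (a - b + b).toNat (by omega) (a := a - b) (b := b) (by omega) hb
        ⟨m, m + k, by linear_combination hmk⟩ rfl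
      exact ⟨false :: u, by simp [wordCoord, hu]⟩

/-- The regions behind a directed edge are indexed by the words in two letters. -/
theorem bijective_word_OmegaMinus {e : DirectedEdge} {G : ℤ → ℤ → Region} (hG : IsChart G)
    (hX : G 1 0 = e.X) (hY : G 0 1 = e.Y) (hW : G 1 1 = e.W) (hZ : G 1 (-1) = e.Z) :
    Function.Bijective fun u : List Bool => (⟨G (wordCoord u).1 (wordCoord u).2,
      (mem_OmegaMinus_iff hG hX hY hW hZ).2 ⟨_, _, (wordCoord_pos u).1, (wordCoord_pos u).2,
        isCoprime_wordCoord u, rfl⟩⟩ : e.OmegaMinus) := by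
  constructor
  · intro u v huv
    have hd := (hG.eq_iff (isCoprime_wordCoord u) (isCoprime_wordCoord v)).1
      (congrArg Subtype.val huv)
    have hu := wordCoord_pos u
    have hv := wordCoord_pos v
    have cu := isCoprime_wordCoord u
    have cv := isCoprime_wordCoord v
    apply wordCoord_injective
    -- Positive coprime pairs of equal ratio divide each other.
    have d1 : (wordCoord u).1 ∣ (wordCoord v).1 := by
      refine cu.dvd_of_dvd_mul_right (Dvd.intro (wordCoord v).2 ?_)
      linear_combination hd
    have d2 : (wordCoord v).1 ∣ (wordCoord u).1 := by
      refine cv.dvd_of_dvd_mul_right (Dvd.intro (wordCoord u).2 ?_)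
      linear_combination -hd
    have e1 : (wordCoord u).1 = (wordCoord v).1 :=
      Int.dvd_antisymm hu.1.le hv.1.le d1 d2
    refine Prod.ext e1 ?_
    rw [e1] at hd
    have : (wordCoord v).1 * ((wordCoord v).2 - (wordCoord u).2) = 0 := by linear_combination hd
    rcases mul_eq_zero.1 this with h | h <;> omega
  · rintro ⟨R, hR⟩
    obtain ⟨a, b, ha, hb, hab, rfl⟩ := (mem_OmegaMinus_iff hG hX hY hW hZ).1 hR
    obtain ⟨u, hu⟩ := exists_wordCoord_eq ha hb hab
    exact ⟨u, by simp [hu]⟩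

/-! ### The binary tree of edges behind a directed edge -/

/-- The values of a Markoff map at the regions around an edge directed away from the root: `x`
and `y` at the two sides, `z` at the region behind. -/
@[ext]
structure EdgeValues where
  x : ℂ
  y : ℂ
  z : ℂ

namespace EdgeValues

/-- The value at the region in front, given by the edge relation. -/
def front (s : EdgeValues) : ℂ := s.x * s.y - s.z

/-- The two edges leading on. The second side of each is the region just met, so that following
the boundary of the region `x` means choosing `false` forever. -/
def child (s : EdgeValues) : Bool → EdgeValues
  | false => ⟨s.x, s.front, s.y⟩
  | true => ⟨s.y, s.front, s.x⟩

/-- The edge reached by a word. -/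
def descend : EdgeValues → List Bool → EdgeValues
  | s, [] => s
  | s, b :: u => (s.child b).descend u

/-- The left-hand side of the vertex relation. -/
def vertexForm (s : EdgeValues) : ℂ := s.x ^ 2 + s.y ^ 2 + s.z ^ 2 - s.x * s.y * s.z

theorem vertexForm_child (s : EdgeValues) (b : Bool) : (s.child b).vertexForm = s.vertexForm := by
  cases b <;> simp only [child, vertexForm, front] <;> ring

theorem descend_append (s : EdgeValues) (u v : List Bool) :
    s.descend (u ++ v) = (s.descend u).descend v := by
  induction u generalizing s with
  | nil => rfl
  | cons b u ih => rw [List.cons_append, descend, ih, descend]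

end EdgeValues

/-- The words of length `n`. -/
def wordsOfLength : ℕ → Finset (List Bool)
  | 0 => {[]}
  | n + 1 => (wordsOfLength n).image (List.cons false) ∪ (wordsOfLength n).image (List.cons true)

/-- The words of length less than `n`. -/
def wordsBelow : ℕ → Finset (List Bool)
  | 0 => ∅
  | n + 1 => insert [] ((wordsBelow n).image (List.cons false) ∪
      (wordsBelow n).image (List.cons true))

theorem mem_wordsOfLength {n : ℕ} {u : List Bool} : u ∈ wordsOfLength n ↔ u.length = n := by
  induction n generalizing u with
  | zero => simp [wordsOfLength]
  | succ n ih => rcases u with _ | ⟨_ | _, u⟩ <;> simp [wordsOfLength, ih]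

theorem mem_wordsBelow {n : ℕ} {u : List Bool} : u ∈ wordsBelow n ↔ u.length < n := by
  induction n generalizing u with
  | zero => simp [wordsBelow]
  | succ n ih => rcases u with _ | ⟨_ | _, u⟩ <;> simp [wordsBelow, ih]

theorem exists_subset_wordsBelow (F : Finset (List Bool)) : ∃ n, F ⊆ wordsBelow n :=
  ⟨F.sup List.length + 1, fun _ hu => mem_wordsBelow.2 (Nat.lt_succ_of_le (Finset.le_sup hu))⟩

theorem tendsto_wordsBelow : Tendsto wordsBelow atTop atTop := by
  refine tendsto_atTop.2 fun F => ?_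
  obtain ⟨n, hn⟩ := exists_subset_wordsBelow F
  filter_upwards [eventually_ge_atTop n] with m hm
  exact hn.trans fun u hu => mem_wordsBelow.2 ((mem_wordsBelow.1 hu).trans_le hm)

theorem disjoint_image_cons (F : Finset (List Bool)) :
    Disjoint (F.image (List.cons false)) (F.image (List.cons true)) := by
  simp [Finset.disjoint_left]

theorem sum_wordsBelow_succ {M : Type*} [AddCommMonoid M] (f : List Bool → M) (n : ℕ) :
    ∑ u ∈ wordsBelow (n + 1), f u =
      f [] + (∑ u ∈ wordsBelow n, f (false :: u) + ∑ u ∈ wordsBelow n, f (true :: u)) := by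
  rw [wordsBelow, Finset.sum_insert (by simp), Finset.sum_union (disjoint_image_cons _),
    Finset.sum_image (by simp), Finset.sum_image (by simp)]

@[to_additive]
theorem prod_wordsOfLength_succ {M : Type*} [CommMonoid M] (f : List Bool → M) (n : ℕ) :
    ∏ u ∈ wordsOfLength (n + 1), f u =
      (∏ u ∈ wordsOfLength n, f (false :: u)) * ∏ u ∈ wordsOfLength n, f (true :: u) := by
  rw [wordsOfLength, Finset.prod_union (disjoint_image_cons _),
    Finset.prod_image (by simp), Finset.prod_image (by simp)]

namespace EdgeValues

/-! ### Growth along properly directed edges -/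

/-- The weight `|w|⁻²` of the region in front. -/
noncomputable def weight (s : EdgeValues) : ℝ := 1 / ‖s.front‖ ^ 2

theorem weight_nonneg (s : EdgeValues) : 0 ≤ s.weight := by unfold weight; positivity

/-- Both sides exceed `2` in modulus, and the modulus does not decrease from behind to front. -/
structure IsExpanding (s : EdgeValues) : Prop where
  two_lt_x : 2 < ‖s.x‖
  two_lt_y : 2 < ‖s.y‖
  le_front : ‖s.z‖ ≤ ‖s.front‖

theorem IsExpanding.mul_le {s : EdgeValues} (h : s.IsExpanding) :
    ‖s.x‖ * ‖s.y‖ ≤ 2 * ‖s.front‖ := by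
  have h1 : s.x * s.y = s.z + s.front := by simp [front]
  have h2 := norm_add_le s.z s.front
  rw [← h1, norm_mul] at h2
  linarith [h.le_front]

theorem IsExpanding.two_lt_front {s : EdgeValues} (h : s.IsExpanding) : 2 < ‖s.front‖ := by
  have := mul_lt_mul'' h.two_lt_x h.two_lt_y (by norm_num) (by norm_num)
  linarith [h.mul_le]

theorem IsExpanding.child {s : EdgeValues} (h : s.IsExpanding) (b : Bool) :
    (s.child b).IsExpanding := by
  -- With sides `a`, `w` and the region `c` behind, `|aw - c| < |c|` would force `|a| < 2`.
  have key : ∀ a c : ℂ, 2 < ‖a‖ → 2 < ‖c‖ → ‖a‖ * ‖c‖ ≤ 2 * ‖s.front‖ →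
      ‖c‖ ≤ ‖a * s.front - c‖ := by
    intro a c ha hc hm
    by_contra hlt
    push Not at hlt
    have h1 := norm_add_le (a * s.front - c) c
    rw [sub_add_cancel, norm_mul] at h1
    have h2 : ‖a‖ * (‖a‖ * ‖c‖) ≤ ‖a‖ * (2 * ‖s.front‖) :=
      mul_le_mul_of_nonneg_left hm (norm_nonneg _)
    have h3 : 4 * ‖c‖ < ‖a‖ * ‖a‖ * ‖c‖ := by
      have := mul_lt_mul'' ha ha (by norm_num) (by norm_num)
      exact mul_lt_mul_of_pos_right (by linarith) (by linarith)
    nlinarith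
  have hm := h.mul_le
  cases b
  · exact ⟨h.two_lt_x, h.two_lt_front, key _ _ h.two_lt_x h.two_lt_y hm⟩
  · exact ⟨h.two_lt_y, h.two_lt_front, key _ _ h.two_lt_y h.two_lt_x ((mul_comm _ _).trans_le hm)⟩

/-- The values behind `s` grow fast enough: the modulus never decreases from behind to front, and
the total weight is at most `B`. -/
structure IsTame (s : EdgeValues) (B : ℝ) : Prop where
  le_front : ∀ u, ‖(s.descend u).z‖ ≤ ‖(s.descend u).front‖
  sum_le : ∀ n, ∑ u ∈ wordsBelow n, (s.descend u).weight ≤ B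

/-- Bound for the total weight behind an expanding edge. With `p = 4 / |x|²` and `q = 4 / |y|²` it
is a quarter of `∑ pᵃ qᵇ` over all `a, b ≥ 1`; the weight of the region with coordinates `(a, b)` is
at most the corresponding term, and only coprime pairs occur. -/
noncomputable def expandingBound (s : EdgeValues) : ℝ :=
  4 / ((‖s.x‖ ^ 2 - 4) * (‖s.y‖ ^ 2 - 4))

theorem expandingBound_step {X Y W : ℝ} (hX : 4 < X) (hY : 4 < Y) (hW : X * Y ≤ 4 * W) :
    1 / W + (4 / ((X - 4) * (W - 4)) + 4 / ((Y - 4) * (W - 4))) ≤ 4 / ((X - 4) * (Y - 4)) := by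
  have hX' : 0 < X - 4 := by linarith
  have hY' : 0 < Y - 4 := by linarith
  have hW4 : 0 < W - 4 := by nlinarith
  have hW0 : 0 < W := by linarith
  have h1 : 0 < (X - 4) * (Y - 4) := mul_pos hX' hY'
  have h2 : 0 ≤ W + 4 - X - Y := by nlinarith
  have h3 : 0 ≤ 4 * W * (W + 4 - X - Y) - (X - 4) * (Y - 4) * (W - 4) := by
    have : (X - 4) * (Y - 4) * (W - 4) ≤ 4 * (W + 4 - X - Y) * (W - 4) :=
      mul_le_mul_of_nonneg_right (by nlinarith) hW4.le
    nlinarith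
  rw [← sub_nonneg]
  have e : 4 / ((X - 4) * (Y - 4))
      - (1 / W + (4 / ((X - 4) * (W - 4)) + 4 / ((Y - 4) * (W - 4))))
      = (4 * W * (W + 4 - X - Y) - (X - 4) * (Y - 4) * (W - 4)) /
        (W * ((X - 4) * (Y - 4)) * (W - 4)) := by
    field_simp
    ring
  rw [e]
  positivity

theorem four_lt_norm_sq {a : ℂ} (h : 2 < ‖a‖) : 4 < ‖a‖ ^ 2 := by nlinarith

theorem IsExpanding.isTame {s : EdgeValues} (h : s.IsExpanding) : s.IsTame s.expandingBound where
  le_front u := by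
    induction u generalizing s with
    | nil => exact h.le_front
    | cons b u ih => exact ih (h.child b)
  sum_le n := by
    induction n generalizing s with
    | zero =>
      have h1 := four_lt_norm_sq h.two_lt_x
      have h2 := four_lt_norm_sq h.two_lt_y
      simp only [wordsBelow, Finset.sum_empty, expandingBound]
      exact div_nonneg (by norm_num) (mul_nonneg (by linarith) (by linarith))
    | succ n ih =>
      rw [sum_wordsBelow_succ]
      have h1 := ih (h.child false)
      have h2 := ih (h.child true)
      have h3 : ‖s.x‖ ^ 2 * ‖s.y‖ ^ 2 ≤ 4 * ‖s.front‖ ^ 2 := by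
        have := pow_le_pow_left₀ (by positivity) h.mul_le 2
        rw [mul_pow, mul_pow] at this
        linarith
      have h4 := expandingBound_step (four_lt_norm_sq h.two_lt_x) (four_lt_norm_sq h.two_lt_y) h3
      simp only [expandingBound, EdgeValues.child] at h1 h2 ⊢
      simp only [descend, weight, EdgeValues.child] at h1 h2 ⊢
      linarith

/-- The total weight behind `s` is finite, and all but finitely many edges behind `s` are directed
towards growing modulus. -/
structure HasGrowth (s : EdgeValues) : Prop where
  summable : Summable fun u => (s.descend u).weight
  finite : {u | ‖(s.descend u).front‖ < ‖(s.descend u).z‖}.Finite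

theorem IsTame.hasGrowth {s : EdgeValues} {B : ℝ} (h : s.IsTame B) : s.HasGrowth where
  summable := by
    refine summable_of_sum_le (c := B) (fun u => weight_nonneg _) fun F => ?_
    obtain ⟨n, hn⟩ := exists_subset_wordsBelow F
    exact (Finset.sum_le_sum_of_subset_of_nonneg hn fun u _ _ => weight_nonneg _).trans (h.sum_le n)
  finite := by
    convert Set.finite_empty
    exact Set.eq_empty_of_forall_notMem fun u hu => (h.le_front u).not_gt hu

theorem hasGrowth_of_children {s : EdgeValues} (h0 : (s.child false).HasGrowth)
    (h1 : (s.child true).HasGrowth) : s.HasGrowth where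
  summable := by
    refine summable_of_sum_le (c := s.weight + (∑' u, ((s.child false).descend u).weight +
      ∑' u, ((s.child true).descend u).weight)) (fun u => weight_nonneg _) fun F => ?_
    obtain ⟨n, hn⟩ := exists_subset_wordsBelow F
    have hn' : F ⊆ wordsBelow (n + 1) := hn.trans fun u hu =>
      mem_wordsBelow.2 ((mem_wordsBelow.1 hu).trans n.lt_succ_self)
    refine (Finset.sum_le_sum_of_subset_of_nonneg hn' fun u _ _ => weight_nonneg _).trans ?_
    rw [sum_wordsBelow_succ]
    gcongr
    · rfl
    · exact h0.summable.sum_le_tsum _ fun u _ => weight_nonneg _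
    · exact h1.summable.sum_le_tsum _ fun u _ => weight_nonneg _
  finite := by
    refine (((h0.finite.image (List.cons false)).union (h1.finite.image (List.cons true))).union
      (Set.finite_singleton [])).subset ?_
    rintro (_ | ⟨_ | _, u⟩) hu
    · simp
    · exact .inl (.inl ⟨u, hu, rfl⟩)
    · exact .inl (.inr ⟨u, hu, rfl⟩)

end EdgeValues

/-! ### Growth around a fixed region -/

theorem add_inv_mem_realSegment {t : ℂ} (ht : ‖t‖ = 1) : t + t⁻¹ ∈ realSegment := by
  refine ⟨2 * t.re, ?_, ?_⟩
  · have := abs_le.1 (Complex.abs_re_le_norm t)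
    rw [ht] at this
    constructor <;> linarith
  · rw [Complex.inv_def, Complex.normSq_eq_norm_sq, ht]
    apply Complex.ext <;> simp
    ring

/-- A number outside `[-2, 2]` is `l + l⁻¹` for some `l` outside the unit circle. -/
theorem exists_eigenvalue {x : ℂ} (hx : x ∉ realSegment) :
    ∃ l : ℂ, 1 < ‖l‖ ∧ x = l + l⁻¹ := by
  obtain ⟨d, hd⟩ := IsAlgClosed.exists_eq_mul_self (x ^ 2 - 4)
  have hprod : (x + d) / 2 * ((x - d) / 2) = 1 := by linear_combination hd / 4
  have h0 : (x + d) / 2 ≠ 0 := left_ne_zero_of_mul_eq_one hprod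
  have hinv : ((x + d) / 2)⁻¹ = (x - d) / 2 := inv_eq_of_mul_eq_one_right hprod
  have hsum : x = (x + d) / 2 + ((x + d) / 2)⁻¹ := by rw [hinv]; ring
  rcases lt_trichotomy ‖(x + d) / 2‖ 1 with h | h | h
  · refine ⟨((x + d) / 2)⁻¹, ?_, by rw [inv_inv, add_comm]; exact hsum⟩
    rw [norm_inv]
    exact (one_lt_inv₀ (norm_pos_iff.2 h0)).2 h
  · exact absurd (hsum ▸ add_inv_mem_realSegment h) hx
  · exact ⟨_, h, hsum⟩

namespace EdgeValues

theorem descend_replicate_succ (s : EdgeValues) (n : ℕ) :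
    s.descend (List.replicate (n + 1) false) =
      (s.descend (List.replicate n false)).child false := by
  rw [List.replicate_succ', descend_append]
  rfl

/-- The regions met while following the region of value `l + l⁻¹` satisfy a linear recurrence with
eigenvalues `l` and `l⁻¹`. -/
theorem descend_replicate {l : ℂ} (hl : l ≠ 0) (p q : ℂ) (n : ℕ) :
    (⟨l + l⁻¹, p * l + q * l⁻¹, p + q⟩ : EdgeValues).descend (List.replicate n false) =
      ⟨l + l⁻¹, p * l ^ (n + 1) + q * l⁻¹ ^ (n + 1), p * l ^ n + q * l⁻¹ ^ n⟩ := by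
  induction n with
  | zero => simp [descend]
  | succ n ih =>
    rw [descend_replicate_succ, ih]
    have h : l * l⁻¹ = 1 := mul_inv_cancel₀ hl
    ext
    · rfl
    · simp only [child, front]
      linear_combination (p * l ^ n + q * l⁻¹ ^ n) * h
    · rfl

/-- Far out along the boundary of a region with value outside `[-2, 2]` whose square is not the
value of the vertex form, the whole tree is tame. -/
theorem exists_isTame_replicate {s : EdgeValues} (hx : s.x ∉ realSegment)
    (hμ : s.x ^ 2 ≠ s.vertexForm) :
    ∃ n B, (s.descend (List.replicate n false)).IsTame B := by
  obtain ⟨l, hl, hxl⟩ := exists_eigenvalue hx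
  have hl0 : l ≠ 0 := norm_pos_iff.1 (one_pos.trans hl)
  have hli : l * l⁻¹ = 1 := mul_inv_cancel₀ hl0
  have hρ : 0 < ‖l‖ := one_pos.trans hl
  have hd : l - l⁻¹ ≠ 0 := by
    intro h
    have h1 : ‖l‖ = ‖l‖⁻¹ := by rw [← norm_inv, ← sub_eq_zero.1 h]
    have h2 : ‖l‖⁻¹ < 1 := inv_lt_one_of_one_lt₀ hl
    linarith
  obtain ⟨p, hp⟩ : ∃ p, p = (s.y - l⁻¹ * s.z) / (l - l⁻¹) := ⟨_, rfl⟩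
  obtain ⟨q, hq⟩ : ∃ q, q = (l * s.z - s.y) / (l - l⁻¹) := ⟨_, rfl⟩
  have hs : s = ⟨l + l⁻¹, p * l + q * l⁻¹, p + q⟩ := by
    ext
    · exact hxl
    · rw [hp, hq, div_mul_eq_mul_div, div_mul_eq_mul_div, ← add_div, eq_div_iff hd]
      ring
    · rw [hp, hq, ← add_div, eq_div_iff hd]
      ring
  have hp0 : p ≠ 0 := by
    rintro rfl
    apply hμ
    have h1 : s.y - l⁻¹ * s.z = 0 := by
      simpa [hd] using hp.symm
    simp only [vertexForm]
    rw [hxl]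
    linear_combination (-(s.y - l * s.z)) * h1 + s.z ^ 2 * hli
  have hp0' : 0 < ‖p‖ := norm_pos_iff.2 hp0
  obtain ⟨Y, hY⟩ : ∃ Y : ℕ → ℂ, Y = fun n => p * l ^ n + q * l⁻¹ ^ n := ⟨_, rfl⟩
  have hray : ∀ n, s.descend (List.replicate n false) = ⟨s.x, Y (n + 1), Y n⟩ := by
    intro n
    conv_lhs => rw [hs]
    rw [descend_replicate hl0, hY, ← hxl]
  have hrec : ∀ n, s.x * Y (n + 1) - Y n = Y (n + 2) := by
    intro n
    rw [hY, hxl]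
    linear_combination (p * l ^ n + q * l⁻¹ ^ n) * hli
  have hlim : Tendsto (fun n => ‖Y n‖ / ‖l‖ ^ n) atTop (𝓝 ‖p‖) := by
    have h1 : Tendsto (fun n => p + q * (l⁻¹ * l⁻¹) ^ n) atTop (𝓝 (p + q * 0)) := by
      refine tendsto_const_nhds.add (tendsto_const_nhds.mul
        (tendsto_pow_atTop_nhds_zero_of_norm_lt_one ?_))
      rw [norm_mul, norm_inv]
      exact mul_lt_one_of_nonneg_of_lt_one_left (by positivity)
        (inv_lt_one_of_one_lt₀ hl) (inv_lt_one_of_one_lt₀ hl).le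
    rw [mul_zero, add_zero] at h1
    refine h1.norm.congr fun n => ?_
    rw [eq_div_iff (by positivity), ← norm_pow, ← norm_mul, hY]
    congr 1
    rw [add_mul, mul_pow, mul_assoc q, mul_assoc (l⁻¹ ^ n), ← mul_pow l⁻¹ l, mul_comm l⁻¹ l, hli,
      one_pow, mul_one]
  -- The ratios `|Y n| / |l| ^ n` end up within a factor `|l|` of their limit `|p|`.
  have hlow : ∀ᶠ n in atTop, ‖p‖ / ‖l‖ < ‖Y n‖ / ‖l‖ ^ n :=
    hlim.eventually (lt_mem_nhds (div_lt_self hp0' hl))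
  have hup : ∀ᶠ n in atTop, ‖Y n‖ / ‖l‖ ^ n < ‖p‖ * ‖l‖ :=
    hlim.eventually (gt_mem_nhds (lt_mul_of_one_lt_right hp0' hl))
  have hbig : ∀ᶠ n in atTop, (3 + ‖s.x‖) / (‖p‖ / ‖l‖) ≤ ‖l‖ ^ n :=
    (tendsto_pow_atTop_atTop_of_one_lt hl).eventually_ge_atTop _
  obtain ⟨N, hN⟩ := eventually_atTop.1 (hlow.and (hup.and hbig))
  obtain ⟨c, hc⟩ : ∃ c, c = ‖p‖ / ‖l‖ := ⟨_, rfl⟩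
  have hc0 : 0 < c := hc ▸ div_pos hp0' hρ
  have hcY : ∀ n ≥ N, c * ‖l‖ ^ n ≤ ‖Y n‖ := fun n hn => by
    have := (lt_div_iff₀ (by positivity)).1 (hN n hn).1
    rw [hc]
    exact this.le
  have hY3 : ∀ n ≥ N, 3 + ‖s.x‖ ≤ ‖Y n‖ := fun n hn => by
    have := (div_le_iff₀ (hc ▸ hc0)).1 (hN n hn).2.2
    refine le_trans ?_ (hcY n hn)
    rw [hc, mul_comm]
    exact this
  have hmono : ∀ n ≥ N, ‖Y n‖ ≤ ‖Y (n + 2)‖ := fun n hn => by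
    have h1 := (div_lt_iff₀ (by positivity)).1 (hN n hn).2.1
    have h2 := (lt_div_iff₀ (by positivity)).1 (hN (n + 2) (by omega)).1
    have h3 : ‖p‖ / ‖l‖ * ‖l‖ ^ (n + 2) = ‖p‖ * ‖l‖ * ‖l‖ ^ n := by
      field_simp
      ring
    linarith
  have hexp : ∀ n ≥ N, ((s.descend (List.replicate n false)).child true).IsExpanding := by
    intro n hn
    rw [hray]
    have h1 := hY3 (n + 1) (by omega)
    have h2 := hY3 (n + 2) (by omega)
    have h0 := norm_nonneg s.x
    refine ⟨?_, ?_, ?_⟩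
    · simp only [child]
      linarith
    · simp only [child, front, hrec]
      linarith
    · simp only [child, front, hrec]
      have h3 := norm_sub_norm_le (Y (n + 1) * Y (n + 2)) s.x
      rw [norm_mul] at h3
      nlinarith
  obtain ⟨r, hr⟩ : ∃ r, r = (‖l‖ ^ 2)⁻¹ := ⟨_, rfl⟩
  have hr0 : 0 < r := by rw [hr]; positivity
  have hr1 : r < 1 := by
    rw [hr]
    exact inv_lt_one_of_one_lt₀ (one_lt_pow₀ hl two_ne_zero)
  obtain ⟨K, hK⟩ : ∃ K, K = 3 / c ^ 2 := ⟨_, rfl⟩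
  have hK0 : 0 < K := by rw [hK]; positivity
  have hstep : ∀ n ≥ N, (s.descend (List.replicate n false)).weight +
      ((s.descend (List.replicate n false)).child true).expandingBound ≤ K * r ^ n := by
    intro n hn
    rw [hray]
    simp only [weight, expandingBound, child, front, hrec]
    have h0 := norm_nonneg s.x
    have h1 : 9 ≤ ‖Y (n + 1)‖ ^ 2 := by nlinarith [hY3 (n + 1) (by omega)]
    have h2 : 9 ≤ ‖Y (n + 2)‖ ^ 2 := by nlinarith [hY3 (n + 2) (by omega)]
    have h3 : 4 / ((‖Y (n + 1)‖ ^ 2 - 4) * (‖Y (n + 2)‖ ^ 2 - 4)) ≤ 2 / ‖Y (n + 2)‖ ^ 2 := by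
      rw [div_le_div_iff₀ (by nlinarith) (by linarith)]
      nlinarith
    have h4 : (c * ‖l‖ ^ n) ^ 2 ≤ ‖Y (n + 2)‖ ^ 2 := by
      refine pow_le_pow_left₀ (by positivity) ?_ 2
      exact (hcY n hn).trans (hmono n hn)
    have h5 : 3 / ‖Y (n + 2)‖ ^ 2 ≤ 3 / (c * ‖l‖ ^ n) ^ 2 := by gcongr
    have h6 : 3 / (c * ‖l‖ ^ n) ^ 2 = K * r ^ n := by
      rw [hK, hr, inv_pow, mul_pow, ← pow_mul, ← pow_mul, mul_comm n 2]
      field_simp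
    have h7 : 3 / ‖Y (n + 2)‖ ^ 2 = 1 / ‖Y (n + 2)‖ ^ 2 + 2 / ‖Y (n + 2)‖ ^ 2 := by ring
    linarith
  have htame : ∀ k, ∀ n ≥ N, ∑ u ∈ wordsBelow k,
      ((s.descend (List.replicate n false)).descend u).weight ≤ K * r ^ n / (1 - r) := by
    intro k
    induction k with
    | zero =>
      intro n _
      simp only [wordsBelow, Finset.sum_empty]
      exact div_nonneg (by positivity) (by linarith)
    | succ k ih =>
      intro n hn
      rw [sum_wordsBelow_succ]
      have h1 := ih (n + 1) (by omega)
      have h2 := (hexp n hn).isTame.sum_le k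
      have h3 := hstep n hn
      rw [descend_replicate_succ] at h1
      simp only [descend] at h1 h2 ⊢
      have h4 : K * r ^ n + K * r ^ (n + 1) / (1 - r) = K * r ^ n / (1 - r) := by
        have : 1 - r ≠ 0 := by linarith
        field_simp
        ring
      linarith
  refine ⟨N, K * r ^ N / (1 - r), fun u => ?_, fun k => htame k N le_rfl⟩
  have hle : ∀ u : List Bool, ∀ n ≥ N, ‖((s.descend (List.replicate n false)).descend u).z‖ ≤
      ‖((s.descend (List.replicate n false)).descend u).front‖ := by
    intro u
    induction u with
    | nil =>
      intro n hn
      rw [descend, hray]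
      simp only [front, hrec]
      exact hmono n hn
    | cons b u ih =>
      intro n hn
      cases b
      · have := ih (n + 1) (by omega)
        rwa [descend_replicate_succ] at this
      · exact (hexp n hn).isTame.le_front u
  exact hle u N le_rfl

/-! ### Exclusion of infinite descent -/

/-- Quantitative core of the descent: if two consecutive steps decrease the modulus, with all
values of modulus at least `2`, then a small first decrease forces `μ` to be close to `4`. Here
`c₀` is replaced by `c` across the edge with sides `a, b`, and then `a` by `a'` across the edge
with sides `b, c`. -/
theorem norm_sub_four_sq_le {a b c c₀ a' μ : ℂ} {M : ℝ} (h1 : c₀ + c = a * b) (h2 : a + a' = b * c)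
    (hμ : a ^ 2 + b ^ 2 + c ^ 2 - a * b * c = μ) (hb : 2 ≤ ‖b‖) (ha : 2 ≤ ‖a‖)
    (hc : ‖c‖ ≤ ‖c₀‖) (ha' : ‖a'‖ ≤ ‖a‖) (hcM : ‖c₀‖ ≤ M) (haM : ‖a‖ ≤ M) (hbM : ‖b‖ ≤ M) :
    ‖μ - 4‖ ^ 2 ≤ 2 * M * (2 + 3 * M) ^ 2 * (‖c₀‖ - ‖c‖) := by
  obtain ⟨d, hd⟩ : ∃ d, d = ‖c₀‖ - ‖c‖ := ⟨_, rfl⟩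
  have hd0 : 0 ≤ d := by linarith
  have hc0 := norm_nonneg c
  have hM : 2 ≤ M := hb.trans hbM
  have hab : ‖a‖ * ‖b‖ ≤ 2 * ‖c‖ + d := by
    rw [← norm_mul, ← h1]
    linarith [norm_add_le c₀ c]
  have hbc : ‖b‖ * ‖c‖ ≤ 2 * ‖a‖ := by
    rw [← norm_mul, ← h2]
    linarith [norm_add_le a a']
  have hca : ‖c‖ ≤ ‖a‖ := by nlinarith
  have hab' : 2 * ‖c‖ ≤ ‖a‖ * ‖b‖ := by nlinarith
  have hbc' : 2 * ‖a‖ - d ≤ ‖b‖ * ‖c‖ := by nlinarith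
  -- The parallelogram law bounds the deviations of `c` from `ab / 2` and of `a` from `bc / 2`.
  have par1 : ‖c₀ - c‖ ^ 2 ≤ 8 * M * d := by
    have h := parallelogram_law_with_norm ℝ c₀ c
    rw [h1, norm_mul] at h
    have hdM : d ≤ M := by linarith
    have hcM' : ‖c‖ ≤ M := hc.trans hcM
    have h3 : ‖c₀‖ = ‖c‖ + d := by linarith
    rw [h3] at h
    have h4 : (2 * ‖c‖) * (2 * ‖c‖) ≤ (‖a‖ * ‖b‖) * (‖a‖ * ‖b‖) :=
      mul_le_mul hab' hab' (by positivity) (by positivity)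
    have h5 : ‖c‖ * d ≤ M * d := mul_le_mul_of_nonneg_right hcM' hd0
    have h6 : d * d ≤ M * d := mul_le_mul_of_nonneg_right hdM hd0
    nlinarith
  have par2 : ‖a - a'‖ ^ 2 ≤ 8 * M * d := by
    have h := parallelogram_law_with_norm ℝ a a'
    rw [h2, norm_mul] at h
    have h4 : ‖a'‖ * ‖a'‖ ≤ ‖a‖ * ‖a‖ :=
      mul_le_mul ha' ha' (by positivity) (by positivity)
    have h5 : (2 * ‖a‖ - ‖b‖ * ‖c‖) * (2 * ‖a‖ + ‖b‖ * ‖c‖) ≤ d * (4 * M) :=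
      mul_le_mul (by linarith) (by linarith) (by positivity) hd0
    nlinarith
  -- An exact expression of `μ - 4` through those deviations.
  have hb4 : (b ^ 2 - 4) * a = -(2 * (a - a') + b * (c - c₀)) := by
    linear_combination -2 * h2 - b * h1
  have hexpr : μ - 4 = (b ^ 2 - 4) + (c * (c - c₀) + a * (a - a')) / 2 := by
    rw [← hμ]
    linear_combination c / 2 * h1 + a / 2 * h2
  obtain ⟨E, hE⟩ : ∃ E, E = Real.sqrt (8 * M * d) := ⟨_, rfl⟩
  have hE0 : 0 ≤ E := hE ▸ Real.sqrt_nonneg _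
  have hE1 : ‖c - c₀‖ ≤ E := by
    rw [norm_sub_rev, hE]
    exact Real.le_sqrt_of_sq_le par1
  have hE2 : ‖a - a'‖ ≤ E := by
    rw [hE]
    exact Real.le_sqrt_of_sq_le par2
  have hEsq : E ^ 2 = 8 * M * d := by
    rw [hE]
    exact Real.sq_sqrt (by positivity)
  have hbE : ‖b ^ 2 - 4‖ ≤ (2 + M) * E / 2 := by
    have h3 : ‖b ^ 2 - 4‖ * ‖a‖ ≤ 2 * E + M * E := by
      rw [← norm_mul, hb4, norm_neg]
      refine (norm_add_le _ _).trans ?_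
      rw [norm_mul, norm_mul, Complex.norm_ofNat]
      gcongr
    nlinarith [norm_nonneg (b ^ 2 - 4)]
  have hfin : ‖μ - 4‖ ≤ (2 + 3 * M) * E / 2 := by
    rw [hexpr]
    refine (norm_add_le _ _).trans ?_
    have h3 : ‖(c * (c - c₀) + a * (a - a')) / 2‖ ≤ (M * E + M * E) / 2 := by
      rw [norm_div, Complex.norm_ofNat]
      gcongr
      refine (norm_add_le _ _).trans ?_
      rw [norm_mul, norm_mul]
      gcongr
      exact hc.trans hcM
    linarith
  calc ‖μ - 4‖ ^ 2 ≤ ((2 + 3 * M) * E / 2) ^ 2 := by gcongr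
    _ = (2 + 3 * M) ^ 2 * E ^ 2 / 4 := by ring
    _ = 2 * M * (2 + 3 * M) ^ 2 * (‖c₀‖ - ‖c‖) := by rw [hEsq, hd]; ring

/-- There is no infinite path of edges along which all values have modulus greater than `2` and
the modulus decreases from behind to front at each step. -/
theorem no_infinite_descent {p : ℕ → EdgeValues} {b : ℕ → Bool}
    (hp : ∀ n, p (n + 1) = (p n).child (b n)) (hμ : (p 0).vertexForm ≠ 4)
    (hx : ∀ n, 2 < ‖(p n).x‖) (hy : ∀ n, 2 < ‖(p n).y‖)
    (hlt : ∀ n, ‖(p n).front‖ < ‖(p n).z‖) : False := by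
  obtain ⟨S, hS⟩ : ∃ S : ℕ → ℝ, S = fun n => ‖(p n).x‖ + ‖(p n).y‖ + ‖(p n).z‖ := ⟨_, rfl⟩
  have hform : ∀ n, (p n).vertexForm = (p 0).vertexForm := by
    intro n
    induction n with
    | zero => rfl
    | succ n ih => rw [hp, vertexForm_child, ih]
  have hstep : ∀ n, S (n + 1) = S n - (‖(p n).z‖ - ‖(p n).front‖) := by
    intro n
    rw [hS]
    simp only [hp]
    cases b n <;> simp only [child] <;> ring
  have hS0 : ∀ n, 0 ≤ S n := fun n => by rw [hS]; positivity
  have hSle : ∀ n, S n ≤ S 0 := by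
    intro n
    induction n with
    | zero => rfl
    | succ n ih => linarith [hstep n, hlt n]
  have hxM : ∀ n, ‖(p n).x‖ ≤ S 0 := fun n => by
    have := hSle n
    rw [hS] at this ⊢
    linarith [norm_nonneg (p n).y, norm_nonneg (p n).z]
  have hyM : ∀ n, ‖(p n).y‖ ≤ S 0 := fun n => by
    have := hSle n
    rw [hS] at this ⊢
    linarith [norm_nonneg (p n).x, norm_nonneg (p n).z]
  have hzM : ∀ n, ‖(p n).z‖ ≤ S 0 := fun n => by
    have := hSle n
    rw [hS] at this ⊢
    linarith [norm_nonneg (p n).x, norm_nonneg (p n).y]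
  have hM : 2 < S 0 := (hx 0).trans_le (hxM 0)
  have hdrop : ∀ n, ‖(p 0).vertexForm - 4‖ ^ 2 ≤
      2 * S 0 * (2 + 3 * S 0) ^ 2 * (‖(p n).z‖ - ‖(p n).front‖) := by
    intro n
    have h1 := hlt (n + 1)
    rw [hp] at h1
    rw [← hform n]
    cases hb : b n
    · rw [hb] at h1
      simp only [child] at h1
      refine norm_sub_four_sq_le (a := (p n).y) (b := (p n).x) (a' := (p n).x * (p n).front - (p n).y)
        ?_ ?_ ?_ (hx n).le (hy n).le (hlt n).le h1.le (hzM n) (hyM n) (hxM n)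
      · simp only [front]; ring
      · ring
      · simp only [front, vertexForm]; ring
    · rw [hb] at h1
      simp only [child] at h1
      refine norm_sub_four_sq_le (a := (p n).x) (b := (p n).y) (a' := (p n).y * (p n).front - (p n).x)
        ?_ ?_ ?_ (hy n).le (hx n).le (hlt n).le h1.le (hzM n) (hxM n) (hyM n)
      · simp only [front]; ring
      · ring
      · simp only [front, vertexForm]; ring
  obtain ⟨K, hK⟩ : ∃ K, K = 2 * S 0 * (2 + 3 * S 0) ^ 2 := ⟨_, rfl⟩
  have hK0 : 0 < K := by rw [hK]; positivity
  obtain ⟨δ, hδ⟩ : ∃ δ, δ = ‖(p 0).vertexForm - 4‖ ^ 2 / K := ⟨_, rfl⟩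
  have hδ0 : 0 < δ := by
    rw [hδ]
    have : 0 < ‖(p 0).vertexForm - 4‖ := norm_pos_iff.2 (sub_ne_zero.2 hμ)
    positivity
  have hlin : ∀ n : ℕ, S n ≤ S 0 - n * δ := by
    intro n
    induction n with
    | zero => simp
    | succ n ih =>
      have h1 : δ ≤ ‖(p n).z‖ - ‖(p n).front‖ := by
        rw [hδ, div_le_iff₀ hK0, mul_comm, hK]
        exact hdrop n
      push_cast
      linarith [hstep n]
  obtain ⟨n, hn⟩ := exists_nat_gt (S 0 / δ)
  rw [div_lt_iff₀ hδ0] at hn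
  linarith [hlin n, hS0 n]

/-! ### Growth of admissible values -/

/-- The conditions on the values at and behind an edge: the vertex relation, no value in
`[-2, 2]`, only finitely many of modulus at most `2`, and the two sides not square roots
of `μ`. -/
structure IsAdmissible (μ : ℂ) (s : EdgeValues) : Prop where
  vertexForm_eq : s.vertexForm = μ
  x_notMem : s.x ∉ realSegment
  y_notMem : s.y ∉ realSegment
  x_sq_ne : s.x ^ 2 ≠ μ
  y_sq_ne : s.y ^ 2 ≠ μ
  front_notMem : ∀ u, (s.descend u).front ∉ realSegment
  finite : {u | ‖(s.descend u).front‖ ≤ 2}.Finite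

theorem zero_mem_realSegment : (0 : ℂ) ∈ realSegment := ⟨0, by norm_num, by simp⟩

theorem ne_zero_of_notMem {x : ℂ} (hx : x ∉ realSegment) : x ≠ 0 := by
  rintro rfl
  exact hx zero_mem_realSegment

/-- If the region in front took the value `±√μ`, the values around it would form a geometric
progression, which decays in one of the two directions. -/
theorem IsAdmissible.front_sq_ne {μ : ℂ} {s : EdgeValues} (h : s.IsAdmissible μ) :
    s.front ^ 2 ≠ μ := by
  intro hw
  have hx := ne_zero_of_notMem h.x_notMem
  have hy := ne_zero_of_notMem h.y_notMem
  have hxy : s.x ^ 2 + s.y ^ 2 = s.x * s.y * s.front := by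
    have := h.vertexForm_eq
    rw [← hw] at this
    simp only [vertexForm, front] at this ⊢
    linear_combination this
  obtain ⟨t, ht⟩ : ∃ t, t = s.x / s.y := ⟨_, rfl⟩
  have ht0 : t ≠ 0 := by rw [ht]; exact div_ne_zero hx hy
  have hft : s.front = t + t⁻¹ := by
    rw [ht, inv_div, div_add_div _ _ hy hx, eq_div_iff (mul_ne_zero hy hx)]
    linear_combination -hxy
  have hxt : s.x = s.y * t := by rw [ht]; field_simp
  -- A geometric progression of ratio `t` with `|t| < 1` yields infinitely many small values.
  have decay : ∀ (b : Bool) (q t : ℂ), t ≠ 0 → ‖t‖ < 1 →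
      (s.child b).child true = ⟨t + t⁻¹, q * t, q⟩ → False := by
    intro b q t ht0 ht1 hs
    have hray : ∀ n : ℕ, (s.descend (b :: true :: List.replicate n false)).front =
        q * t ^ (n + 2) := by
      intro n
      have h1 := descend_replicate ht0 q 0 n
      simp only [zero_mul, add_zero] at h1
      rw [descend, descend, hs, h1]
      simp only [front]
      linear_combination q * t ^ n * mul_inv_cancel₀ ht0
    have hlim : Tendsto (fun n : ℕ => q * t ^ (n + 2)) atTop (𝓝 (q * 0)) :=
      tendsto_const_nhds.mul ((tendsto_pow_atTop_nhds_zero_of_norm_lt_one ht1).comp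
        (tendsto_add_atTop_nat 2))
    rw [mul_zero] at hlim
    have hev : ∀ᶠ n : ℕ in atTop, ‖q * t ^ (n + 2)‖ < 2 :=
      hlim.norm.eventually (gt_mem_nhds (by simp))
    obtain ⟨N, hN⟩ := eventually_atTop.1 hev
    refine Set.infinite_of_injective_forall_mem
      (f := fun n : ℕ => b :: true :: List.replicate (n + N) false) (fun m n hmn => ?_)
      (fun n => ?_) h.finite
    · simpa using congrArg List.length hmn
    · rw [Set.mem_ofPred_eq, hray]
      exact (hN (n + N) (by omega)).le
  rcases lt_trichotomy ‖t‖ 1 with h1 | h1 | h1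
  · refine decay false s.x t ht0 h1 ?_
    ext
    · exact hft
    · simp only [child, front] at hft ⊢
      rw [hft, mul_add, hxt]
      field_simp
      ring
    · rfl
  · exact h.front_notMem [] (by rw [descend, hft]; exact add_inv_mem_realSegment h1)
  · refine decay true s.y t⁻¹ (inv_ne_zero ht0) ?_ ?_
    · rw [norm_inv]
      exact inv_lt_one_of_one_lt₀ h1
    · ext
      · rw [inv_inv, add_comm]
        exact hft
      · simp only [child, front] at hft ⊢
        rw [hft, mul_add, hxt]
        ring
      · rfl

theorem IsAdmissible.child {μ : ℂ} {s : EdgeValues} (h : s.IsAdmissible μ) (b : Bool) :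
    (s.child b).IsAdmissible μ where
  vertexForm_eq := (vertexForm_child s b).trans h.vertexForm_eq
  x_notMem := by cases b; exacts [h.x_notMem, h.y_notMem]
  y_notMem := by cases b <;> exact h.front_notMem []
  x_sq_ne := by cases b; exacts [h.x_sq_ne, h.y_sq_ne]
  y_sq_ne := by cases b <;> exact h.front_sq_ne
  front_notMem u := h.front_notMem (b :: u)
  finite := h.finite.preimage (f := List.cons b) (List.cons_injective.injOn)

theorem IsAdmissible.descend {μ : ℂ} {s : EdgeValues} (h : s.IsAdmissible μ) (u : List Bool) :
    (s.descend u).IsAdmissible μ := by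
  induction u generalizing s with
  | nil => exact h
  | cons b u ih => exact ih (h.child b)

/-- Failure of growth propagates along an infinite path. -/
theorem exists_path_of_not_hasGrowth {s : EdgeValues} (hs : ¬ s.HasGrowth) :
    ∃ (p : ℕ → EdgeValues) (b : ℕ → Bool), p 0 = s ∧ (∀ n, p (n + 1) = (p n).child (b n)) ∧
      ∀ n, ¬ (p n).HasGrowth := by
  have hchoose : ∀ t : {t : EdgeValues // ¬ t.HasGrowth}, ∃ b, ¬ (t.1.child b).HasGrowth := by
    intro t
    by_contra! hcon
    exact t.2 (hasGrowth_of_children (hcon false) (hcon true))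
  choose c hc using hchoose
  let P : ℕ → {t : EdgeValues // ¬ t.HasGrowth} := fun n =>
    Nat.rec ⟨s, hs⟩ (fun _ t => ⟨t.1.child (c t), hc t⟩) n
  exact ⟨fun n => (P n).1, fun n => c (P n), rfl, fun n => rfl, fun n => (P n).2⟩

/-- Away from `μ = 4`, admissible values grow: an infinite path on which growth fails would either
turn infinitely often, and then descend forever, or follow the boundary of one region. -/
theorem IsAdmissible.hasGrowth {μ : ℂ} (hμ : μ ≠ 4) {s : EdgeValues} (hs : s.IsAdmissible μ) :
    s.HasGrowth := by
  by_contra hcon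
  obtain ⟨p, b, hp0, hp, hbad⟩ := exists_path_of_not_hasGrowth hcon
  have hword : ∀ n, p n = s.descend ((List.range n).map b) := by
    intro n
    induction n with
    | zero => rw [hp0]; rfl
    | succ n ih =>
      rw [hp, List.range_succ, List.map_append, descend_append, ← ih]
      rfl
  have hadm : ∀ n, (p n).IsAdmissible μ := fun n => by rw [hword]; exact hs.descend _
  by_cases hturn : ∀ N, ∃ n ≥ N, b n = true
  · have hbig : ∀ᶠ n in atTop, 2 < ‖(p n).front‖ := by
      have hinj : Function.Injective fun n : ℕ => (List.range n).map b := fun m n hmn => by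
        simpa using congrArg List.length hmn
      have h1 := hinj.tendsto_cofinite.eventually hs.finite.eventually_cofinite_notMem
      rw [Nat.cofinite_eq_atTop] at h1
      filter_upwards [h1] with n hn
      rw [hword]
      simpa using hn
    obtain ⟨N, hN⟩ := eventually_atTop.1 hbig
    have hy : ∀ n ≥ N + 1, 2 < ‖(p n).y‖ := by
      intro n hn
      obtain ⟨m, rfl⟩ : ∃ m, n = m + 1 := ⟨n - 1, by omega⟩
      rw [hp]
      cases b m <;> exact hN m (by omega)
    obtain ⟨m, hm, hbm⟩ := hturn (N + 1)
    have hx : ∀ n ≥ m + 1, 2 < ‖(p n).x‖ := by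
      intro n hn
      induction n, hn using Nat.le_induction with
      | base =>
        rw [hp, hbm]
        exact hy m hm
      | succ n hn ih =>
        rw [hp]
        cases b n
        · exact ih
        · exact hy n (by omega)
    have hlt : ∀ n ≥ m + 1, ‖(p n).front‖ < ‖(p n).z‖ := by
      intro n hn
      by_contra hle
      exact hbad n (IsExpanding.isTame ⟨hx n hn, hy n (by omega), not_lt.1 hle⟩).hasGrowth
    refine no_infinite_descent (p := fun n => p (m + 1 + n)) (b := fun n => b (m + 1 + n))
      (fun n => hp _) ?_ (fun n => hx _ (by omega)) (fun n => hy _ (by omega))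
      fun n => hlt _ (by omega)
    rw [(hadm _).vertexForm_eq]
    exact hμ
  · push Not at hturn
    obtain ⟨N, hN⟩ := hturn
    have hray : ∀ n, p (N + n) = (p N).descend (List.replicate n false) := by
      intro n
      induction n with
      | zero => rfl
      | succ n ih =>
        rw [descend_replicate_succ, ← ih, ← add_assoc, hp]
        simp [Bool.eq_false_iff.2 (hN (N + n) (by omega))]
    obtain ⟨n, B, hB⟩ := exists_isTame_replicate (s := p N) (hadm N).x_notMem
      (by rw [(hadm N).vertexForm_eq]; exact (hadm N).x_sq_ne)
    rw [← hray] at hB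
    exact hbad _ hB.hasGrowth

end EdgeValues

/-! ### The functions `h`, `𝔥` and their exponentials -/

theorem sqrt_sq (a : ℂ) : Complex.sqrt a ^ 2 = a := by
  exact Complex.cpow_nat_inv_pow a (n := 2) two_ne_zero

theorem sqrt_ne_zero {a : ℂ} (ha : a ≠ 0) : Complex.sqrt a ≠ 0 := fun h0 => by
  have := sqrt_sq a
  rw [h0] at this
  exact ha (by simpa using this.symm)

theorem exp_nu_add_exp_neg_nu (μ : ℂ) :
    Complex.exp (nu μ) + Complex.exp (-nu μ) = 2 - μ := by
  obtain ⟨c, hc⟩ : ∃ c, c = Complex.sqrt (1 - μ / 2 - 1) * Complex.sqrt (1 - μ / 2 + 1) := ⟨_, rfl⟩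
  have hc2 : c ^ 2 = (1 - μ / 2) ^ 2 - 1 := by
    rw [hc, mul_pow, sqrt_sq, sqrt_sq]
    ring
  have hprod : (1 - μ / 2 + c) * (1 - μ / 2 - c) = 1 := by linear_combination -hc2
  have h1 : Complex.exp (nu μ) = 1 - μ / 2 + c := by
    rw [nu, arcosh, ← hc, Complex.exp_log (left_ne_zero_of_mul_eq_one hprod)]
  rw [Complex.exp_neg, h1, inv_eq_of_mul_eq_one_right hprod]
  ring

/-- The function `1 + (e^ν - 1) t`. -/
noncomputable def posFactor (μ t : ℂ) : ℂ := 1 + (Complex.exp (nu μ) - 1) * t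

/-- The function `1 + (e^{-ν} - 1) t`. -/
noncomputable def negFactor (μ t : ℂ) : ℂ := 1 + (Complex.exp (-nu μ) - 1) * t

theorem exp_nu_sub_one_sq (μ : ℂ) :
    (Complex.exp (nu μ) - 1) ^ 2 = -μ * Complex.exp (nu μ) := by
  have h1 := exp_nu_add_exp_neg_nu μ
  have h2 : Complex.exp (nu μ) * Complex.exp (-nu μ) = 1 := by
    rw [← Complex.exp_add, add_neg_cancel, Complex.exp_zero]
  linear_combination Complex.exp (nu μ) * h1 - h2

theorem posFactor_mul_negFactor (μ t : ℂ) :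
    posFactor μ t * negFactor μ t = 1 - μ * (t * (1 - t)) := by
  have h1 := exp_nu_add_exp_neg_nu μ
  have h2 : Complex.exp (nu μ) * Complex.exp (-nu μ) = 1 := by
    rw [← Complex.exp_add, add_neg_cancel, Complex.exp_zero]
  unfold posFactor negFactor
  linear_combination (t - t ^ 2) * h1 + t ^ 2 * h2

theorem h_mul_one_sub_h (x : ℂ) : h x * (1 - h x) = 1 / x ^ 2 := by
  have := sqrt_sq (1 - 4 / x ^ 2)
  unfold h
  linear_combination -this / 4

theorem re_h_le (x : ℂ) : (h x).re ≤ 1 / 2 := by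
  have h1 : 0 ≤ (Complex.sqrt (1 - 4 / x ^ 2)).re := by
    rw [Complex.sqrt, Complex.cpow_inv_two_re]
    exact Real.sqrt_nonneg _
  have h2 : (h x).re = (1 - (Complex.sqrt (1 - 4 / x ^ 2)).re) / 2 := by
    simp [h]
  linarith

theorem re_h_lt {x : ℂ} (hx : x ∉ realSegment) : (h x).re < 1 / 2 := by
  refine lt_of_le_of_ne (re_h_le x) fun heq => hx ?_
  obtain ⟨a, ha⟩ : ∃ a, a = 1 - 4 / x ^ 2 := ⟨_, rfl⟩
  have h2 : (h x).re = (1 - (Complex.sqrt a).re) / 2 := by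
    simp [h, ha]
  have h3 : (Complex.sqrt a).re = 0 := by linarith
  rw [Complex.sqrt, Complex.cpow_inv_two_re, Real.sqrt_eq_zero'] at h3
  have h4 := (abs_le.1 (Complex.abs_re_le_norm a)).1
  have h5 : ‖a‖ = -a.re := by linarith
  -- A square root with vanishing real part means that `a` is a nonpositive real number.
  have h6 : a.im = 0 := by
    have h7 := Complex.sq_norm a
    rw [Complex.normSq_apply, h5] at h7
    have : a.im * a.im = 0 := by linarith
    simpa using this
  have h7 : 0 ≤ -a.re := h5 ▸ norm_nonneg a
  have h8 : a = (a.re : ℂ) := Complex.ext (by simp) (by simp [h6])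
  by_cases hx0 : x = 0
  · rw [hx0]
    exact EdgeValues.zero_mem_realSegment
  have h9 : x ^ 2 * (1 - a) = 4 := by
    rw [ha]
    field_simp
    ring
  obtain ⟨r, hr⟩ : ∃ r, r = Real.sqrt (1 - a.re) := ⟨_, rfl⟩
  have hr1 : 1 ≤ r := by
    rw [hr]
    exact Real.one_le_sqrt.2 (by linarith)
  have hr2 : (r : ℂ) ^ 2 = 1 - a := by
    rw [h8, hr]
    norm_cast
    exact Real.sq_sqrt (by linarith)
  have hr0 : (r : ℂ) ≠ 0 := by
    norm_cast
    linarith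
  have h10 : (x * r - 2) * (x * r + 2) = 0 := by
    linear_combination h9 + x ^ 2 * hr2
  have h11 : 2 / r ≤ 2 := div_le_self (by norm_num) hr1
  have h12 : 0 ≤ 2 / r := by positivity
  rcases mul_eq_zero.1 h10 with h | h
  · refine ⟨2 / r, ⟨by linarith, h11⟩, ?_⟩
    push_cast
    rw [div_eq_iff hr0]
    linear_combination -h
  · refine ⟨-(2 / r), ⟨by linarith, by linarith⟩, ?_⟩
    push_cast
    rw [← neg_div, div_eq_iff hr0]
    linear_combination -h

theorem norm_h_le (x : ℂ) : ‖h x‖ ≤ 2 * (1 / ‖x‖ ^ 2) := by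
  have h1 := congrArg norm (h_mul_one_sub_h x)
  rw [norm_mul, norm_div, norm_one, norm_pow] at h1
  have h2 : 1 / 2 ≤ ‖1 - h x‖ := by
    refine le_trans ?_ (Complex.re_le_norm _)
    rw [Complex.sub_re, Complex.one_re]
    linarith [re_h_le x]
  rw [← h1]
  nlinarith [norm_nonneg (h x)]

theorem posFactor_mul_negFactor_h (μ x : ℂ) :
    posFactor μ (h x) * negFactor μ (h x) = 1 - μ / x ^ 2 := by
  rw [posFactor_mul_negFactor, h_mul_one_sub_h]
  ring

theorem one_sub_div_sq_ne_zero {μ x : ℂ} (hx0 : x ≠ 0) (hx : x ^ 2 ≠ μ) : 1 - μ / x ^ 2 ≠ 0 := by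
  rw [sub_ne_zero, ne_comm, Ne, div_eq_one_iff_eq (pow_ne_zero 2 hx0)]
  exact hx.symm

theorem posFactor_h_ne_zero {μ x : ℂ} (hx0 : x ≠ 0) (hx : x ^ 2 ≠ μ) : posFactor μ (h x) ≠ 0 :=
  left_ne_zero_of_mul (posFactor_mul_negFactor_h μ x ▸ one_sub_div_sq_ne_zero hx0 hx)

theorem negFactor_h_ne_zero {μ x : ℂ} (hx0 : x ≠ 0) (hx : x ^ 2 ≠ μ) : negFactor μ (h x) ≠ 0 :=
  right_ne_zero_of_mul (posFactor_mul_negFactor_h μ x ▸ one_sub_div_sq_ne_zero hx0 hx)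

theorem exp_frakH {μ x : ℂ} (hx0 : x ≠ 0) (hx : x ^ 2 ≠ μ) :
    Complex.exp (frakH μ x) = posFactor μ (h x) / negFactor μ (h x) :=
  Complex.exp_log (div_ne_zero (posFactor_h_ne_zero hx0 hx) (negFactor_h_ne_zero hx0 hx))

theorem exp_frakHHat {μ x : ℂ} (hx0 : x ≠ 0) (hx : x ^ 2 ≠ μ) :
    Complex.exp (frakHHat μ x) = posFactor μ (h x) / Complex.sqrt (1 - μ / x ^ 2) :=
  Complex.exp_log (div_ne_zero (posFactor_h_ne_zero hx0 hx)
    (sqrt_ne_zero (one_sub_div_sq_ne_zero hx0 hx)))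

namespace EdgeValues

/-! ### The product formula -/

/-- The ratio of `exp ψ(e)` and `exp 𝔥̂(x) exp 𝔥̂(y)` at an edge with sides `x`, `y`. -/
noncomputable def ratio (μ : ℂ) (s : EdgeValues) : ℂ :=
  posFactor μ (s.z / (s.x * s.y)) / (posFactor μ (h s.x) * posFactor μ (h s.y))

theorem IsAdmissible.ratio_eq {μ : ℂ} {s : EdgeValues} (hs : s.IsAdmissible μ) :
    s.ratio μ = (s.child false).ratio μ * (s.child true).ratio μ *
      Complex.exp (frakH μ s.front) := by
  have hx := ne_zero_of_notMem hs.x_notMem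
  have hy := ne_zero_of_notMem hs.y_notMem
  have hw := ne_zero_of_notMem (hs.front_notMem [])
  have hws := hs.front_sq_ne
  rw [EdgeValues.descend] at hw
  obtain ⟨w, hwdef⟩ : ∃ w, w = s.front := ⟨_, rfl⟩
  rw [exp_frakH hw hws]
  have n1 := posFactor_h_ne_zero hx hs.x_sq_ne
  have n2 := posFactor_h_ne_zero hy hs.y_sq_ne
  have n3 := posFactor_h_ne_zero hw hws
  have n4 := negFactor_h_ne_zero hw hws
  have key : posFactor μ (s.z / (s.x * s.y)) * (1 - μ / s.front ^ 2) =
      posFactor μ (s.y / (s.x * s.front)) * posFactor μ (s.x / (s.y * s.front)) := by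
    have hk := exp_nu_sub_one_sq μ
    have hv := hs.vertexForm_eq
    rw [← hwdef] at hw ⊢
    have hz : s.z = s.x * s.y - w := by rw [hwdef]; simp only [front]; ring
    have hv' : s.z * w = s.x ^ 2 + s.y ^ 2 - μ := by
      rw [← hv, hz]
      simp only [vertexForm]
      rw [hz]
      ring
    unfold posFactor
    obtain ⟨k, hkdef⟩ : ∃ k, k = Complex.exp (nu μ) - 1 := ⟨_, rfl⟩
    have hE : Complex.exp (nu μ) = k + 1 := by rw [hkdef]; ring
    rw [hE] at hk ⊢
    field_simp
    linear_combination k * w * hv' - s.x * s.y * hk - k * μ * hz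
  have e0 : (s.child false).ratio μ = posFactor μ (s.y / (s.x * s.front)) /
      (posFactor μ (h s.x) * posFactor μ (h s.front)) := rfl
  have e1 : (s.child true).ratio μ = posFactor μ (s.x / (s.y * s.front)) /
      (posFactor μ (h s.y) * posFactor μ (h s.front)) := rfl
  rw [e0, e1, ratio]
  rw [← posFactor_mul_negFactor_h] at key
  field_simp
  linear_combination key

theorem IsAdmissible.ratio_eq_prod {μ : ℂ} {s : EdgeValues} (hs : s.IsAdmissible μ) (n : ℕ) :
    s.ratio μ = (∏ u ∈ wordsOfLength n, (s.descend u).ratio μ) *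
      Complex.exp (∑ u ∈ wordsBelow n, frakH μ (s.descend u).front) := by
  induction n generalizing s with
  | zero => simp [wordsOfLength, wordsBelow, EdgeValues.descend]
  | succ n ih =>
    rw [hs.ratio_eq, ih (hs.child false), ih (hs.child true), prod_wordsOfLength_succ,
      sum_wordsBelow_succ, Complex.exp_add, Complex.exp_add]
    simp only [EdgeValues.descend]
    ring

/-- The sides of an edge further on are old sides or regions met on the way. -/
theorem forall_sides {P : ℂ → Prop} {s : EdgeValues} (hx : P s.x) (hy : P s.y)
    (hf : ∀ u, P (s.descend u).front) (u : List Bool) : P (s.descend u).x ∧ P (s.descend u).y := by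
  induction u generalizing s with
  | nil => exact ⟨hx, hy⟩
  | cons b u ih =>
    cases b
    · exact ih hx (hf []) fun v => hf (false :: v)
    · exact ih hy (hf []) fun v => hf (true :: v)

theorem HasGrowth.tendsto_h {s : EdgeValues} (hs : s.HasGrowth) :
    Tendsto (fun u => h (s.descend u).front) cofinite (𝓝 0) := by
  refine squeeze_zero_norm (fun u => norm_h_le _) ?_
  have := hs.summable.tendsto_cofinite_zero.const_mul 2
  rwa [mul_zero] at this

theorem HasGrowth.summable_frakH {s : EdgeValues} (hs : s.HasGrowth) (μ : ℂ) :
    Summable fun u => ‖frakH μ (s.descend u).front‖ := by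
  obtain ⟨g, hg⟩ : ∃ g : ℂ → ℂ, g = fun t => Complex.log (posFactor μ t / negFactor μ t) :=
    ⟨_, rfl⟩
  have hg0 : g 0 = 0 := by simp [hg, posFactor, negFactor]
  have hd : DifferentiableAt ℂ g 0 := by
    rw [hg]
    have hn : negFactor μ 0 ≠ 0 := by simp [negFactor]
    refine DifferentiableAt.clog ?_ (by simp [posFactor, negFactor])
    refine DifferentiableAt.fun_div ?_ ?_ hn
    · unfold posFactor; fun_prop
    · unfold negFactor; fun_prop
  have hO : g =O[𝓝 0] fun t => t := by
    have := hd.isBigO_sub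
    simpa [hg0] using this
  have hO2 := hO.comp_tendsto hs.tendsto_h
  have hO3 : (fun u => h (s.descend u).front) =O[cofinite] fun u => (s.descend u).weight := by
    refine Asymptotics.IsBigO.of_bound 2 (Eventually.of_forall fun u => ?_)
    rw [Real.norm_of_nonneg (weight_nonneg _)]
    exact norm_h_le _
  have hfin := (hO2.trans hO3).norm_left
  rw [hg] at hfin
  exact summable_of_isBigO hs.summable hfin

/-- If the modulus grows from behind to front, then `z / (x y)` is close to `h x` for large `y`,
because `t = z / (x y)` and `h = h x` satisfy `(t - h) (1 - t - h) = (1 - μ / x²) / y²` and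
`Re t ≤ 1 / 2`. -/
theorem norm_div_sub_h_le {μ : ℂ} {s : EdgeValues} (hv : s.vertexForm = μ) (hx : s.x ≠ 0)
    (hy : s.y ≠ 0) (hle : ‖s.z‖ ≤ ‖s.front‖) :
    ‖s.z / (s.x * s.y) - h s.x‖ * (1 / 2 - (h s.x).re) ≤
      ‖1 - μ / s.x ^ 2‖ * (1 / ‖s.y‖ ^ 2) := by
  obtain ⟨t, ht⟩ : ∃ t, t = s.z / (s.x * s.y) := ⟨_, rfl⟩
  have ht1 : 1 - t = s.front / (s.x * s.y) := by
    rw [ht, front]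
    field_simp
  have htt : t * (1 - t) = (s.x ^ 2 + s.y ^ 2 - μ) / (s.x ^ 2 * s.y ^ 2) := by
    rw [ht1, ht, ← hv]
    simp only [vertexForm, front]
    field_simp
    ring
  have hprod : (t - h s.x) * (1 - t - h s.x) = (1 - μ / s.x ^ 2) * (1 / s.y ^ 2) := by
    have h1 := h_mul_one_sub_h s.x
    have h2 : (t - h s.x) * (1 - t - h s.x) = t * (1 - t) - h s.x * (1 - h s.x) := by ring
    rw [h2, h1, htt]
    field_simp
    ring
  have hre : t.re ≤ 1 / 2 := by
    have h1 : ‖t‖ ≤ ‖1 - t‖ := by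
      rw [ht1, ht, norm_div, norm_div]
      gcongr
    have h2 := pow_le_pow_left₀ (norm_nonneg _) h1 2
    rw [Complex.sq_norm, Complex.sq_norm, Complex.normSq_apply, Complex.normSq_apply] at h2
    simp only [Complex.sub_re, Complex.one_re, Complex.sub_im, Complex.one_im] at h2
    nlinarith
  have hlow : 1 / 2 - (h s.x).re ≤ ‖1 - t - h s.x‖ := by
    refine le_trans ?_ (Complex.re_le_norm _)
    simp only [Complex.sub_re, Complex.one_re]
    linarith
  have hn := congrArg norm hprod
  rw [norm_mul, norm_mul, norm_div, norm_one, norm_pow] at hn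
  rw [← ht, ← hn]
  gcongr

/-- The deviation of the ratio from `1` is controlled by the second side alone, as long as the
quantity bounded by `C` stays under control for the first side. -/
theorem norm_ratio_sub_one_le {μ : ℂ} {s : EdgeValues} (hv : s.vertexForm = μ)
    (hx : s.x ∉ realSegment) (hxs : s.x ^ 2 ≠ μ)
    (hy : s.y ≠ 0) (hle : ‖s.z‖ ≤ ‖s.front‖) {C : ℝ}
    (hC : ‖1 - μ / s.x ^ 2‖ / ((1 / 2 - (h s.x).re) * ‖posFactor μ (h s.x)‖) ≤ C)
    (hN : 1 / 2 ≤ ‖posFactor μ (h s.y)‖) :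
    ‖s.ratio μ - 1‖ ≤ ‖Complex.exp (nu μ) - 1‖ * (2 * C + 4) * (1 / ‖s.y‖ ^ 2) := by
  have hx0 := ne_zero_of_notMem hx
  have hre : 0 < 1 / 2 - (h s.x).re := by linarith [re_h_lt hx]
  have n1 : posFactor μ (h s.x) ≠ 0 := posFactor_h_ne_zero hx0 hxs
  have n1' : 0 < ‖posFactor μ (h s.x)‖ := norm_pos_iff.2 n1
  have n2 : posFactor μ (h s.y) ≠ 0 := norm_pos_iff.1 (by linarith)
  have h1 := norm_div_sub_h_le hv hx0 hy hle
  obtain ⟨t, ht⟩ : ∃ t, t = s.z / (s.x * s.y) := ⟨_, rfl⟩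
  obtain ⟨k, hk⟩ : ∃ k, k = Complex.exp (nu μ) - 1 := ⟨_, rfl⟩
  rw [← ht] at h1
  have hexpr : s.ratio μ - 1 = k * ((t - h s.x) / posFactor μ (h s.x) - h s.y) /
      posFactor μ (h s.y) := by
    rw [ratio, ← ht]
    field_simp
    simp only [posFactor, ← hk]
    ring
  obtain ⟨W, hW⟩ : ∃ W, W = 1 / ‖s.y‖ ^ 2 := ⟨_, rfl⟩
  have hW0 : 0 ≤ W := by rw [hW]; positivity
  rw [← hW] at h1 ⊢
  have h2 : ‖(t - h s.x) / posFactor μ (h s.x)‖ ≤ C * W := by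
    rw [norm_div]
    refine le_trans ?_ (mul_le_mul_of_nonneg_right hC hW0)
    rw [div_le_iff₀ n1']
    calc ‖t - h s.x‖ ≤ ‖1 - μ / s.x ^ 2‖ * W / (1 / 2 - (h s.x).re) := (le_div_iff₀ hre).2 h1
      _ = _ := by field_simp
  have h3 : ‖h s.y‖ ≤ 2 * W := by
    rw [hW]
    exact norm_h_le _
  rw [hexpr, norm_div, norm_mul, div_le_iff₀ (by linarith)]
  have h4 : ‖(t - h s.x) / posFactor μ (h s.x) - h s.y‖ ≤ (C + 2) * W :=
    (norm_sub_le _ _).trans (by linarith)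
  have hCW : 0 ≤ (C + 2) * W := (norm_nonneg _).trans h4
  rw [← hk]
  calc ‖k‖ * ‖(t - h s.x) / posFactor μ (h s.x) - h s.y‖ ≤ ‖k‖ * ((C + 2) * W) := by gcongr
    _ = ‖k‖ * ((C + 2) * W) * 2 * (1 / 2) := by ring
    _ ≤ ‖k‖ * ((C + 2) * W) * 2 * ‖posFactor μ (h s.y)‖ := by gcongr
    _ = _ := by ring

/-- Apart from finitely many edges, the deviation of the ratio from `1` is bounded by a multiple of
the weight of the region just met. -/
theorem IsAdmissible.exists_norm_ratio_child_le {μ : ℂ} {s : EdgeValues} (hs : s.IsAdmissible μ)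
    (hg : s.HasGrowth) : ∃ C, ∀ᶠ u in cofinite, ∀ b,
      ‖((s.descend u).child b).ratio μ - 1‖ ≤ C * (s.descend u).weight := by
  obtain ⟨κ, hκ⟩ : ∃ κ : ℂ → ℝ, κ = fun x =>
      ‖1 - μ / x ^ 2‖ / ((1 / 2 - (h x).re) * ‖posFactor μ (h x)‖) := ⟨_, rfl⟩
  have hpos : Tendsto (fun u => ‖posFactor μ (h (s.descend u).front)‖) cofinite (𝓝 1) := by
    have : Tendsto (fun u => posFactor μ (h (s.descend u).front)) cofinite
        (𝓝 (1 + (Complex.exp (nu μ) - 1) * 0)) :=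
      tendsto_const_nhds.add (hg.tendsto_h.const_mul _)
    simpa using this.norm
  obtain ⟨B, hB⟩ : ∃ B, ∀ u, κ (s.descend u).front ≤ B := by
    have h1 : Tendsto (fun u => ‖1 - μ / (s.descend u).front ^ 2‖) cofinite (𝓝 1) := by
      have h2 : Tendsto (fun u => μ / (s.descend u).front ^ 2) cofinite (𝓝 0) := by
        rw [tendsto_zero_iff_norm_tendsto_zero]
        have := hg.summable.tendsto_cofinite_zero.const_mul ‖μ‖
        rw [mul_zero] at this
        refine this.congr fun u => ?_
        rw [norm_div, norm_pow, weight, mul_one_div]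
      have h3 : Tendsto (fun u => 1 - μ / (s.descend u).front ^ 2) cofinite (𝓝 (1 - 0)) :=
        tendsto_const_nhds.sub h2
      simpa using h3.norm
    have h2 : Tendsto (fun u => 1 / 2 - (h (s.descend u).front).re) cofinite (𝓝 (1 / 2)) := by
      have h3 : Tendsto (fun u => 1 / 2 - (h (s.descend u).front).re) cofinite
          (𝓝 (1 / 2 - (0 : ℂ).re)) :=
        tendsto_const_nhds.sub ((Complex.continuous_re.tendsto 0).comp hg.tendsto_h)
      simpa using h3
    have h3 := (h1.div (h2.mul hpos) (by norm_num)).bddAbove_range_of_cofinite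
    obtain ⟨B, hB⟩ := h3
    refine ⟨B, fun u => hB ⟨u, ?_⟩⟩
    rw [hκ]
    rfl
  obtain ⟨C, hC⟩ : ∃ C, C = max B (max (κ s.x) (κ s.y)) := ⟨_, rfl⟩
  have hside := forall_sides (P := fun x => κ x ≤ C) (s := s) (by rw [hC]; simp) (by rw [hC]; simp)
    fun u => (hB u).trans (by rw [hC]; simp)
  refine ⟨‖Complex.exp (nu μ) - 1‖ * (2 * C + 4), ?_⟩
  have hdir : ∀ b : Bool, ∀ᶠ u in cofinite,
      ‖((s.descend u).child b).z‖ ≤ ‖((s.descend u).child b).front‖ := by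
    intro b
    have hinj : Function.Injective fun u : List Bool => u ++ [b] :=
      List.append_left_injective [b]
    filter_upwards [hinj.tendsto_cofinite.eventually hg.finite.eventually_cofinite_notMem] with u hu
    simpa [descend_append, EdgeValues.descend] using hu
  filter_upwards [hdir false, hdir true, hpos.eventually (lt_mem_nhds one_half_lt_one)]
    with u h0 h1 h2 b
  have ha := (hs.descend u).child b
  have hle : ‖((s.descend u).child b).z‖ ≤ ‖((s.descend u).child b).front‖ := by
    cases b
    exacts [h0, h1]
  have hκx : κ ((s.descend u).child b).x ≤ C := by
    cases b
    exacts [(hside u).1, (hside u).2]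
  have hyf : ((s.descend u).child b).y = (s.descend u).front := by cases b <;> rfl
  rw [hκ] at hκx
  have := norm_ratio_sub_one_le ha.vertexForm_eq ha.x_notMem ha.x_sq_ne
    (ne_zero_of_notMem ha.y_notMem) hle hκx (by rw [hyf]; exact h2.le)
  rwa [hyf] at this

theorem sum_wordsOfLength_snoc (f : List Bool → ℝ) (n : ℕ) :
    ∑ u ∈ wordsOfLength (n + 1), f u =
      ∑ u ∈ wordsOfLength n, (f (u ++ [false]) + f (u ++ [true])) := by
  induction n generalizing f with
  | zero =>
    rw [sum_wordsOfLength_succ]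
    simp [wordsOfLength]
  | succ n ih =>
    rw [sum_wordsOfLength_succ, ih, ih, sum_wordsOfLength_succ]
    rfl

theorem tendsto_sum_wordsOfLength {f : List Bool → ℝ} (hf : Summable f) :
    Tendsto (fun n => ∑ u ∈ wordsOfLength n, f u) atTop (𝓝 0) := by
  have h1 : Tendsto (fun n => ∑ u ∈ wordsBelow n, f u) atTop (𝓝 (∑' u, f u)) :=
    hf.hasSum.comp tendsto_wordsBelow
  have h2 := (h1.comp (tendsto_add_atTop_nat 1)).sub h1
  rw [sub_self] at h2
  refine h2.congr fun n => ?_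
  have hd : Disjoint (wordsBelow n) (wordsOfLength n) :=
    Finset.disjoint_left.2 fun u h h' => by
      rw [mem_wordsBelow] at h
      rw [mem_wordsOfLength] at h'
      omega
  have hu : wordsBelow (n + 1) = wordsBelow n ∪ wordsOfLength n := by
    ext u
    rw [Finset.mem_union, mem_wordsBelow, mem_wordsBelow, mem_wordsOfLength]
    omega
  rw [Function.comp_apply, hu, Finset.sum_union hd]
  ring

/-- The product of the ratios over the edges at depth `n` tends to `1`. -/
theorem IsAdmissible.tendsto_prod_ratio {μ : ℂ} {s : EdgeValues} (hs : s.IsAdmissible μ)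
    (hg : s.HasGrowth) :
    Tendsto (fun n => ∏ u ∈ wordsOfLength n, (s.descend u).ratio μ) atTop (𝓝 1) := by
  obtain ⟨C, hC⟩ := hs.exists_norm_ratio_child_le hg
  have hsum : Tendsto (fun n => ∑ u ∈ wordsOfLength (n + 1), ‖(s.descend u).ratio μ - 1‖)
      atTop (𝓝 0) := by
    have h1 : Tendsto (fun n => 2 * C * ∑ u ∈ wordsOfLength n, (s.descend u).weight)
        atTop (𝓝 0) := by
      simpa using (tendsto_sum_wordsOfLength hg.summable).const_mul (2 * C)
    obtain ⟨N, hN⟩ := exists_subset_wordsBelow (eventually_cofinite.1 hC).toFinset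
    refine squeeze_zero' (Eventually.of_forall fun n => Finset.sum_nonneg fun u _ => norm_nonneg _)
      ?_ h1
    filter_upwards [eventually_ge_atTop N] with n hn
    rw [sum_wordsOfLength_snoc, Finset.mul_sum]
    refine Finset.sum_le_sum fun u hu => ?_
    have hgood : ∀ b, ‖((s.descend u).child b).ratio μ - 1‖ ≤ C * (s.descend u).weight := by
      by_contra hbad
      have := mem_wordsBelow.1 (hN ((Set.Finite.mem_toFinset _).2 hbad))
      rw [mem_wordsOfLength] at hu
      omega
    have h2 := hgood false
    have h3 := hgood true
    simp only [descend_append, EdgeValues.descend]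
    linarith
  rw [← tendsto_add_atTop_iff_nat 1, tendsto_iff_norm_sub_tendsto_zero]
  have hexp : Tendsto (fun n => Real.exp (∑ u ∈ wordsOfLength (n + 1),
      ‖(s.descend u).ratio μ - 1‖) - 1) atTop (𝓝 0) := by
    have := ((Real.continuous_exp.tendsto 0).comp hsum).sub_const 1
    simpa using this
  refine squeeze_zero (fun n => norm_nonneg _) (fun n => ?_) hexp
  have := Finset.norm_prod_one_add_sub_one_le (wordsOfLength (n + 1))
    fun u => (s.descend u).ratio μ - 1
  simpa using this

/-- The infinite product formula for the edge weight. -/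
theorem IsAdmissible.ratio_eq_exp {μ : ℂ} {s : EdgeValues} (hs : s.IsAdmissible μ)
    (hg : s.HasGrowth) : s.ratio μ = Complex.exp (∑' u, frakH μ (s.descend u).front) := by
  have h1 : Tendsto (fun n => ∑ u ∈ wordsBelow n, frakH μ (s.descend u).front) atTop
      (𝓝 (∑' u, frakH μ (s.descend u).front)) :=
    (hg.summable_frakH μ).of_norm.hasSum.comp tendsto_wordsBelow
  have h2 := (hs.tendsto_prod_ratio hg).mul ((Complex.continuous_exp.tendsto _).comp h1)
  rw [one_mul] at h2
  refine tendsto_nhds_unique (tendsto_const_nhds.congr fun n => ?_) h2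
  exact hs.ratio_eq_prod n

end EdgeValues

/-! ### Markoff maps in adapted coordinates -/

theorem IsMarkoffMap.front_eq {μ : ℂ} {φ : Region → ℂ} (hφ : IsMarkoffMap μ φ)
    {G : ℤ → ℤ → Region} (hG : IsChart G) {a b c d : ℤ}
    (hdet : a * d - c * b = 1 ∨ a * d - c * b = -1) :
    (⟨φ (G a b), φ (G c d), φ (G (a - c) (b - d))⟩ : EdgeValues).front =
      φ (G (a + c) (b + d)) := by
  have d2 : a * (b + d) - (a + c) * b = 1 ∨ a * (b + d) - (a + c) * b = -1 :=
    hdet.imp (fun h => by linarith) fun h => by linarith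
  have d3 : c * (b + d) - (a + c) * d = 1 ∨ c * (b + d) - (a + c) * d = -1 :=
    hdet.symm.imp (fun h => by linarith) fun h => by linarith
  have d4 : a * (b - d) - (a - c) * b = 1 ∨ a * (b - d) - (a - c) * b = -1 :=
    hdet.symm.imp (fun h => by linarith) fun h => by linarith
  have d5 : c * (b - d) - (a - c) * d = 1 ∨ c * (b - d) - (a - c) * d = -1 :=
    hdet.symm.imp (fun h => by linarith) fun h => by linarith
  have swap : ∀ {a b c d : ℤ}, a * d - c * b = 1 ∨ a * d - c * b = -1 →
      c * b - a * d = 1 ∨ c * b - a * d = -1 := fun h => by omega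
  have c1 := isCoprime_of_det hdet
  have c2 := isCoprime_of_det (swap hdet)
  have c3 := isCoprime_of_det (swap d2)
  have c4 := isCoprime_of_det (swap d4)
  have := hφ.edge ⟨G a b, G c d, G (a + c) (b + d), G (a - c) (b - d), (hG.neighbor c1 c2).2 hdet,
    (hG.neighbor c1 c3).2 d2, (hG.neighbor c2 c3).2 d3, (hG.neighbor c1 c4).2 d4,
    (hG.neighbor c2 c4).2 d5, fun heq => by
      have := (hG.eq_iff c3 c4).1 heq
      have h2 : (a + c) * (b - d) - (a - c) * (b + d) = -2 * (a * d - c * b) := by ring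
      omega⟩
  simp only [EdgeValues.front] at this ⊢
  rw [this]
  ring

/-- The value in front of the edge reached by a word is the value of the Markoff map at the region
with the coordinates of that word. -/
theorem IsMarkoffMap.front_descend {μ : ℂ} {φ : Region → ℂ} (hφ : IsMarkoffMap μ φ)
    {G : ℤ → ℤ → Region} (hG : IsChart G) {a b c d : ℤ}
    (hdet : a * d - c * b = 1 ∨ a * d - c * b = -1) (u : List Bool) :
    ((⟨φ (G a b), φ (G c d), φ (G (a - c) (b - d))⟩ : EdgeValues).descend u).front =
      φ (G ((wordCoord u).1 * a + (wordCoord u).2 * c)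
        ((wordCoord u).1 * b + (wordCoord u).2 * d)) := by
  induction u generalizing a b c d with
  | nil =>
    rw [EdgeValues.descend, hφ.front_eq hG hdet]
    simp [wordCoord]
  | cons l u ih =>
    have hab : IsCoprime a b := isCoprime_of_det hdet
    have hcd : IsCoprime c d := isCoprime_of_det (c := a) (d := b) (by omega)
    rw [EdgeValues.descend]
    cases l
    · have hc : (⟨φ (G a b), φ (G c d), φ (G (a - c) (b - d))⟩ : EdgeValues).child false =
          ⟨φ (G a b), φ (G (a + c) (b + d)), φ (G (a - (a + c)) (b - (b + d)))⟩ := by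
        rw [EdgeValues.child, hφ.front_eq hG hdet, sub_add_cancel_left, sub_add_cancel_left,
          hG.neg hcd]
      rw [hc, ih (hdet.imp (fun h => by linarith) fun h => by linarith)]
      simp only [wordCoord]
      congr 2 <;> ring
    · have hc : (⟨φ (G a b), φ (G c d), φ (G (a - c) (b - d))⟩ : EdgeValues).child true =
          ⟨φ (G c d), φ (G (a + c) (b + d)), φ (G (c - (a + c)) (d - (b + d)))⟩ := by
        rw [EdgeValues.child, hφ.front_eq hG hdet, add_comm a c, add_comm b d,
          sub_add_cancel_left, sub_add_cancel_left, hG.neg hab]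
      rw [hc, ih (hdet.symm.imp (fun h => by linarith) fun h => by linarith)]
      simp only [wordCoord]
      congr 2 <;> ring

end GenMarkoff

theorem proposition3p6 (μ : ℂ) (hμ0 : μ ≠ 0) (hμ4 : μ ≠ 4)
    (φ : GenMarkoff.Region → ℂ) (hφ : GenMarkoff.IsMarkoffMap μ φ)
    (e : GenMarkoff.DirectedEdge)
    (hX : φ e.X ^ 2 ≠ μ) (hY : φ e.Y ^ 2 ≠ μ)
    (hfin : (e.Omega0Minus ∩ GenMarkoff.OmegaLE φ 2).Finite)
    (hseg : e.Omega0Minus ∩ φ ⁻¹' GenMarkoff.realSegment = ∅) :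
    (Summable fun R : e.OmegaMinus => ‖GenMarkoff.frakH μ (φ R)‖) ∧
      ∃ k : ℤ, GenMarkoff.edgeWeight μ φ e =
        (GenMarkoff.frakHHat μ (φ e.X) + GenMarkoff.frakHHat μ (φ e.Y)) +
          ∑' R : e.OmegaMinus, GenMarkoff.frakH μ (φ R) + k * (2 * Real.pi * Complex.I) := by
  obtain ⟨G, hG, h10, h01, h11, hZ⟩ := e.exists_chart
  let E : List Bool ≃ e.OmegaMinus :=
    Equiv.ofBijective _ (GenMarkoff.bijective_word_OmegaMinus hG h10 h01 h11 hZ)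
  let s : GenMarkoff.EdgeValues := ⟨φ e.X, φ e.Y, φ e.Z⟩
  have hfront : ∀ u, (s.descend u).front = φ (E u) := by
    intro u
    have := hφ.front_descend hG (a := 1) (b := 0) (c := 0) (d := 1) (by norm_num) u
    rw [sub_zero, zero_sub, h10, h01, hZ] at this
    rw [this]
    simp only [mul_one, mul_zero, add_zero, zero_add]
    rfl
  have hnot : ∀ R ∈ e.Omega0Minus, φ R ∉ GenMarkoff.realSegment := fun R hR hR' =>
    (Set.eq_empty_iff_forall_notMem.1 hseg R) ⟨hR, hR'⟩
  have hXm : e.X ∈ e.Omega0Minus := .inl (by simp [GenMarkoff.DirectedEdge.Omega0])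
  have hYm : e.Y ∈ e.Omega0Minus := .inl (by simp [GenMarkoff.DirectedEdge.Omega0])
  have hadm : s.IsAdmissible μ :=
    { vertexForm_eq := hφ.vertex _ _ _ e.hXY e.hYZ e.hXZ
      x_notMem := hnot _ hXm
      y_notMem := hnot _ hYm
      x_sq_ne := hX
      y_sq_ne := hY
      front_notMem := fun u => by
        rw [hfront]
        exact hnot _ (.inr (E u).2)
      finite := by
        refine (hfin.preimage (f := fun u => (E u : GenMarkoff.Region))
          (Subtype.val_injective.comp E.injective).injOn).subset fun u hu => ?_
        refine ⟨.inr (E u).2, ?_⟩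
        rw [Set.mem_ofPred_eq, hfront] at hu
        exact hu }
  have hg := hadm.hasGrowth hμ4
  refine ⟨?_, ?_⟩
  · rw [← E.summable_iff]
    refine (hg.summable_frakH μ).congr fun u => ?_
    rw [hfront]
    rfl
  · have hX0 : φ e.X ≠ 0 := GenMarkoff.EdgeValues.ne_zero_of_notMem hadm.x_notMem
    have hY0 : φ e.Y ≠ 0 := GenMarkoff.EdgeValues.ne_zero_of_notMem hadm.y_notMem
    have hratio := hadm.ratio_eq_exp hg
    have hsum : ∑' u, GenMarkoff.frakH μ (s.descend u).front =
        ∑' R : e.OmegaMinus, GenMarkoff.frakH μ (φ R) := by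
      rw [← E.tsum_eq]
      exact tsum_congr fun u => by rw [hfront]
    rw [hsum] at hratio
    have n1 := GenMarkoff.posFactor_h_ne_zero hX0 hX
    have n2 := GenMarkoff.posFactor_h_ne_zero hY0 hY
    have n3 := GenMarkoff.sqrt_ne_zero (GenMarkoff.one_sub_div_sq_ne_zero hX0 hX)
    have n4 := GenMarkoff.sqrt_ne_zero (GenMarkoff.one_sub_div_sq_ne_zero hY0 hY)
    have hnum : GenMarkoff.posFactor μ (φ e.Z / (φ e.X * φ e.Y)) =
        Complex.exp (∑' R : e.OmegaMinus, GenMarkoff.frakH μ (φ R)) *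
          (GenMarkoff.posFactor μ (GenMarkoff.h (φ e.X)) *
            GenMarkoff.posFactor μ (GenMarkoff.h (φ e.Y))) := by
      rw [← hratio, GenMarkoff.EdgeValues.ratio]
      exact (div_mul_cancel₀ _ (mul_ne_zero n1 n2)).symm
    have hnum0 : GenMarkoff.posFactor μ (φ e.Z / (φ e.X * φ e.Y)) ≠ 0 := by
      rw [hnum]
      exact mul_ne_zero (Complex.exp_ne_zero _) (mul_ne_zero n1 n2)
    rw [← Complex.exp_eq_exp_iff_exists_int, Complex.exp_add, Complex.exp_add,
      GenMarkoff.exp_frakHHat hX0 hX, GenMarkoff.exp_frakHHat hY0 hY]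
    have hψ : Complex.exp (GenMarkoff.edgeWeight μ φ e) =
        GenMarkoff.posFactor μ (φ e.Z / (φ e.X * φ e.Y)) /
          (Complex.sqrt (1 - μ / φ e.X ^ 2) * Complex.sqrt (1 - μ / φ e.Y ^ 2)) :=
      Complex.exp_log (div_ne_zero hnum0 (mul_ne_zero n3 n4))
    rw [hψ, hnum]
    field_simp
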